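/- Let $\mathbb{K}$ be an algebraically closed field of characteristic zero and let $N, D \ge 2$ be integers. Let $E$ be a finite-dimensional $\mathbb{K}$-vector space, $R \subset E^{\otimes N}$ a subspace, and $\mathcal{A} = A(E,R) = T(E)/(R)$ the associated $N$-homogeneous algebra. For $n \ge N$ put $\mathcal{A}_n^{!*} = \bigcap_{r+s=n-N} E^{\otimes r}\otimes R\otimes E^{\otimes s}\subset E^{\otimes n}$, for $n<N$ put $\mathcal{A}_n^{!*}=E^{\otimes n}$, and let $d : \mathcal{A}\otimes \mathcal{A}_{n+1}^{!*} \to \mathcal{A}\otimes \mathcal{A}_{n}^{!*}$ be induced by $a\otimes(v_0\otimes v_1\otimes\cdots\otimes v_n)\mapsto av_0\otimes (v_1\otimes\cdots\otimes v_n)$. Assume that - $\mathcal{A}$ is Koszul, i.e. the complex $\cdots \xrightarrow{d^{N-1}} \mathcal{A}\otimes\mathcal{A}_{N+1}^{!*} \xrightarrow{d} \mathcal{A}\otimes\mathcal{A}_N^{!*}\xrightarrow{d^{N-1}} \mathcal{A}\otimes\mathcal{A}_1^{!*} \xrightarrow{d} \mathcal{A}\to 0$ (with $d$ and $d^{N-1}$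 alternating) is acyclic in positive degrees; - $\mathcal{A}$ has global dimension $D$; - $\mathcal{A}$ is Gorenstein, i.e. for the trivial left module $\mathbb{K}=\mathcal{A}/\mathcal{A}_+$ one has $\mathrm{Ext}^i_{\mathcal{A}}(\mathbb{K},\mathcal{A})=0$ for $i\neq D$ and $\dim_{\mathbb{K}} \mathrm{Ext}^D_{\mathcal{A}}(\mathbb{K},\mathcal{A})=1$. Let $q = \dim E$ and let $x^1,\dots,x^q$ be any basis of $E$. Then $q=\dim \mathcal{A}_1$, and there are an integer $m\ge N$ and a preregular $m$-linear form $W$ on $\mathbb{K}^q$, with components $W_{\lambda_1\cdots\lambda_m}=W(e_{\lambda_1},\dots,e_{\lambda_m})$ in the canonical basis, such that $\mathcal{A}=\mathcal{A}(W,N)$, that is, $R$ is the subspace of $E^{\otimes N}$ spanned by the elements $\sum_{\mu_1,\dots,\mu_N} W_{\lambda_1\cdots\lambda_{m-N}\mu_1\cdots\mu_N}\, x^{\mu_1}\otimes\cdots\otimes x^{\mu_N}$, $\lambda_i\in\{1,\dots,q\}$. Moreover, if $N\ge 3$, then $m=Np+1$ and $D=2p+1$ for some integer $p\ge 1$, while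 if $N=2$, then $m=D$. Here an $(n+1)$-linear form $W$ on a vector space $V$ ($n \ge 1$) is called preregular if (i) $W(X,X_1,\dots,X_n)=0$ for all $X_1,\dots,X_n\in V$ implies $X=0$, and (ii) there is $Q\in GL(V)$ with $W(X_0,\dots,X_{n-1},X_n)=W(QX_n,X_0,\dots,X_{n-1})$ for all $X_0,\dots,X_n\in V$. -/

import Mathlib

open CategoryTheory
open scoped TensorProduct

universe u

namespace NHomogeneous

noncomputable section

section Algebra

variable {K E : Type u} [Field K] [AddCommGroup E] [Module K E] {N : ℕ}

/-- The elements of `R ⊆ E^{⊗ N}`, seen in the tensor algebra, are the relations set to zero. -/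
inductive Rel (R : Submodule K (⨂[K]^N E)) : TensorAlgebra K E → TensorAlgebra K E → Prop
  | of (r : ⨂[K]^N E) (hr : r ∈ R) : Rel R (TensorPower.toTensorAlgebra r) 0

/-- The `N`-homogeneous algebra `A(E, R) = T(E) / (R)`, where `R ⊆ E^{⊗ N}` and `(R)` is the
two-sided ideal of the tensor algebra generated by `R`. -/
abbrev Alg (R : Submodule K (⨂[K]^N E)) : Type u := RingQuot (Rel R)

/-- The canonical linear map `E^{⊗ n} → A(E, R)`. -/
def ofPower (R : Submodule K (⨂[K]^N E)) (n : ℕ) : ⨂[K]^n E →ₗ[K] Alg R :=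
  (RingQuot.mkAlgHom K (Rel R)).toLinearMap ∘ₗ TensorPower.toTensorAlgebra

/-- The homogeneous component `A_n` of degree `n` of `A = A(E, R)`. -/
def component (R : Submodule K (⨂[K]^N E)) (n : ℕ) : Submodule K (Alg R) :=
  LinearMap.range (ofPower R n)

/-- The canonical linear map `E → A(E, R)`. -/
def gen (R : Submodule K (⨂[K]^N E)) : E →ₗ[K] Alg R :=
  (RingQuot.mkAlgHom K (Rel R)).toLinearMap ∘ₗ TensorAlgebra.ι K

/-- The trivial left `A`-module `K = A / A_+`, where `A_+` is the (left) ideal generated by the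
elements of degree one. -/
def trivialModule (R : Submodule K (⨂[K]^N E)) : ModuleCat.{u} (Alg R) :=
  ModuleCat.of (Alg R) (Alg R ⧸ (Ideal.span (Set.range (gen R)) : Ideal (Alg R)))

/-- The subspace `E^{⊗ r} ⊗ R ⊗ E^{⊗ s}` of `E^{⊗ n}`, where `n = r + N + s`. -/
def shiftedRelations (R : Submodule K (⨂[K]^N E)) {n : ℕ} (r s : ℕ) (h : r + N + s = n) :
    Submodule K (⨂[K]^n E) :=
  Submodule.span K {t | ∃ (a : ⨂[K]^r E) (ρ : ⨂[K]^N E) (b : ⨂[K]^s E), ρ ∈ R ∧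
    t = TensorPower.cast K E h
      (TensorPower.mulEquiv (TensorPower.mulEquiv (a ⊗ₜ[K] ρ) ⊗ₜ[K] b))}

/-- The subspace `(A^!_n)^* ⊆ E^{⊗ n}`: the intersection of all `E^{⊗ r} ⊗ R ⊗ E^{⊗ s}` with
`r + N + s = n`. It is the whole of `E^{⊗ n}` for `n < N`. -/
def dualComponent (R : Submodule K (⨂[K]^N E)) (n : ℕ) : Submodule K (⨂[K]^n E) :=
  ⨅ (r : ℕ) (s : ℕ) (h : r + N + s = n), shiftedRelations R r s h

/-- The term `A ⊗ (A^!_n)^*` of the Koszul `N`-complex, as a subspace of `A ⊗ E^{⊗ n}`. -/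
def koszulTerm (R : Submodule K (⨂[K]^N E)) (n : ℕ) : Submodule K (Alg R ⊗[K] ⨂[K]^n E) :=
  LinearMap.range ((dualComponent R n).subtype.lTensor (Alg R))

variable (K E) in
/-- The linear map `E^{⊗ (n + 1)} → E ⊗ E^{⊗ n}` splitting off the first factor. -/
def splitFirst (n : ℕ) : ⨂[K]^(n + 1) E →ₗ[K] E ⊗[K] ⨂[K]^n E :=
  PiTensorProduct.lift (LinearMap.uncurryLeft
    { toFun := fun v => (TensorProduct.mk K E (⨂[K]^n E) v).compMultilinearMap
        (PiTensorProduct.tprod K)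
      map_add' := fun v w => by ext; simp
      map_smul' := fun c v => by ext; simp [TensorProduct.smul_tmul'] })

/-- The differential `A ⊗ E^{⊗ (n + 1)} → A ⊗ E^{⊗ n}`,
`a ⊗ (v₀ ⊗ v₁ ⊗ ⋯ ⊗ vₙ) ↦ a v₀ ⊗ (v₁ ⊗ ⋯ ⊗ vₙ)`. -/
def koszulD (R : Submodule K (⨂[K]^N E)) (n : ℕ) :
    Alg R ⊗[K] ⨂[K]^(n + 1) E →ₗ[K] Alg R ⊗[K] ⨂[K]^n E :=
  ((LinearMap.mul' K (Alg R) ∘ₗ (gen R).lTensor (Alg R)).rTensor (⨂[K]^n E)) ∘ₗ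
    (TensorProduct.assoc K (Alg R) E (⨂[K]^n E)).symm.toLinearMap ∘ₗ
    (splitFirst K E n).lTensor (Alg R)

theorem koszulD_tmul_tprod (R : Submodule K (⨂[K]^N E)) (n : ℕ) (a : Alg R)
    (v : Fin (n + 1) → E) :
    koszulD R n (a ⊗ₜ[K] PiTensorProduct.tprod K v) =
      (a * gen R (v 0)) ⊗ₜ[K] PiTensorProduct.tprod K (Fin.tail v) := by
  simp [koszulD, splitFirst, Fin.tail_def]

/-- The `k`-fold composite `d^k : A ⊗ E^{⊗ (n + k)} → A ⊗ E^{⊗ n}`. -/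
def koszulDPow (R : Submodule K (⨂[K]^N E)) (n : ℕ) :
    (k : ℕ) → (Alg R ⊗[K] ⨂[K]^(n + k) E →ₗ[K] Alg R ⊗[K] ⨂[K]^n E)
  | 0 => LinearMap.id
  | k + 1 => koszulDPow R n k ∘ₗ koszulD R (n + k)

/-- `A(E, R)` is Koszul: its Koszul complex
`⋯ → K_{2N} → K_{N + 1} → K_N → K_1 → K_0`, where `K_n = A ⊗ (A^!_n)^*` and the arrows are
alternately `d : K_{Nk + 1} → K_{Nk}` and `d^{N - 1} : K_{N(k + 1)} → K_{Nk + 1}`, is acyclic in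
positive degrees. Here `N(k + 1)` is written `Nk + 1 + (N - 1)`. -/
structure IsKoszul (R : Submodule K (⨂[K]^N E)) : Prop where
  exact_odd : ∀ k : ℕ, ∀ z ∈ koszulTerm R (N * k + 1), koszulD R (N * k) z = 0 →
    ∃ y ∈ koszulTerm R (N * k + 1 + (N - 1)), koszulDPow R (N * k + 1) (N - 1) y = z
  exact_even : ∀ k : ℕ, ∀ z ∈ koszulTerm R (N * k + 1 + (N - 1)),
    koszulDPow R (N * k + 1) (N - 1) z = 0 →
    ∃ y ∈ koszulTerm R (N * k + 1 + (N - 1) + 1), koszulD R (N * k + 1 + (N - 1)) y = z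

/-- `A(E, R)` is Gorenstein in dimension `D`: for left modules, `Ext^i_A(K, A) = 0` for `i ≠ D`
and `Ext^D_A(K, A)` is one-dimensional. -/
structure IsGorenstein (R : Submodule K (⨂[K]^N E)) (D : ℕ) : Prop where
  isZero_ext : ∀ i : ℕ, i ≠ D → Limits.IsZero
    (((Ext K (ModuleCat.{u} (Alg R)) i).obj (Opposite.op (trivialModule R))).obj
      (ModuleCat.of (Alg R) (Alg R)))
  finrank_ext : Module.finrank K
    (((Ext K (ModuleCat.{u} (Alg R)) D).obj (Opposite.op (trivialModule R))).obj
      (ModuleCat.of (Alg R) (Alg R))) = 1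

end Algebra

/-- The (left) global dimension of a ring: the supremum of the projective dimensions of its left
modules. -/
def globalDimension (A : Type u) [Ring A] : WithBot ℕ∞ :=
  ⨆ M : ModuleCat.{u} A, projectiveDimension M

section Forms

variable {K : Type u} [Field K]

/-- An `(n + 1)`-linear form `W` on `V`, `n ≥ 1`, is preregular. -/
structure IsPreregular {V : Type u} [AddCommGroup V] [Module K V] {n : ℕ}
    (W : MultilinearMap K (fun _ : Fin (n + 1) => V) K) : Prop where
  one_le : 1 ≤ n
  nondegenerate : ∀ X : V, (∀ Y : Fin n → V, W (Fin.cons X Y) = 0) → X = 0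
  twisted_cyclic : ∃ Q : V ≃ₗ[K] V, ∀ (Y : Fin n → V) (X : V),
    W (Fin.snoc Y X) = W (Fin.cons (Q X) Y)

/-- For an `m`-linear form `W` on `K^q` with components `W_{λ₁ ⋯ λ_m}` in the canonical basis,
and a basis `x^1, …, x^q` of `E`, the space of relations
`∑_μ W_{λ₁ ⋯ λ_{m - N} μ₁ ⋯ μ_N} x^{μ₁} ⊗ ⋯ ⊗ x^{μ_N} = 0` of the algebra `𝒜(W, N)` generated
by the `x^λ`, where `m = j + N`. -/
def formRelations {E : Type u} [AddCommGroup E] [Module K E] {q m j N : ℕ}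
    (x : Module.Basis (Fin q) K E) (W : MultilinearMap K (fun _ : Fin m => Fin q → K) K)
    (h : m = j + N) : Submodule K (⨂[K]^N E) :=
  Submodule.span K (Set.range fun lam : Fin j → Fin q =>
    ∑ mu : Fin N → Fin q,
      W (fun i => Pi.single (Fin.append lam mu (Fin.cast h i)) 1) •
        PiTensorProduct.tprod K (fun i => x (mu i)))

end Forms

end

end NHomogeneous

/-! Write `P_i = A ⊗ V_i` for the terms of the Koszul complex, where `V_i` is the dual component of
degree `ν(i)`, with `ν(2k) = Nk` and `ν(2k+1) = Nk+1`. By Koszulity this is a free resolution of the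
trivial module. It is minimal: its differentials have coefficients in `A_+`, so every coboundary of
`Hom_A(P, A)` is killed by the augmentation. Global dimension `D` therefore forces `V_{D+1} = 0`,
and one-dimensionality of `Ext^D(K, A)` forces `V_D` to be a line `K w`, with every element of `A_+`
the value at `w` of a coboundary (`exists_generator_of_finrank_ext_eq_one`). The components of `W`
are the coordinates of `w`.

Applied to the generators of `A`, this shows that the last differential has degree one
(`koszulStep_eq_one_of_surjective`), which decides the parity of `D` when `N ≥ 3`, and that the left
contractions `w(c ·)` are independent (`slices_linearIndependent`). Vanishing of `Ext^{D-1}(K, A)`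
shows that they span `V_{D-1}` (`slices_span_eq_top`). The right contractions `w(· c)` also lie in
`V_{D-1}`, hence are combinations of the left ones: this is the twisted cyclicity, with matrix `Q`.
Moving letters around cyclically shows that `Q` is injective.

Contractions of `w` down to degree `N` lie in `R` by definition of the dual component. Conversely,
an element of `R` defines a cocycle in degree `D-1`; writing it as a coboundary exhibits the element
as a combination of right contractions of `w` (`exists_dual_apply_slice_eq`), and cyclicity turns
these into left ones.

Tensors are handled as functions on words in `Fin q`, so that degrees do not appear in types; the
grading of `A` is replaced by coefficients in degrees below `N`, where `A` agrees with the tensor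
algebra. -/

namespace NHomogeneous

noncomputable section

/-! ### Projective resolutions from exact sequences of modules. -/

section Resolution

variable {A : Type u} [Ring A] {P : ℕ → Type u} [∀ i, AddCommGroup (P i)] [∀ i, Module A (P i)]
  {M : Type u} [AddCommGroup M] [Module A M]

/-- The chain complex of `A`-modules given by a sequence of linear maps with `d ∘ d = 0`. -/
def chainComplexOf (d : ∀ i, P (i + 1) →ₗ[A] P i) (hd : ∀ i, d i ∘ₗ d (i + 1) = 0) :
    ChainComplex (ModuleCat.{u} A) ℕ :=
  ChainComplex.of (fun i => ModuleCat.of A (P i)) (fun i => ModuleCat.ofHom (d i))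
    (fun i => by rw [← ModuleCat.ofHom_comp, hd i]; rfl)

theorem chainComplexOf_d (d : ∀ i, P (i + 1) →ₗ[A] P i) (hd : ∀ i, d i ∘ₗ d (i + 1) = 0) (i : ℕ) :
    (chainComplexOf d hd).d (i + 1) i = ModuleCat.ofHom (d i) :=
  ChainComplex.of_d (fun i => ModuleCat.of A (P i)) (fun i => ModuleCat.ofHom (d i)) i

/-- An exact sequence `⋯ → P 1 → P 0 → M → 0` with projective terms `P i`, as a projective
resolution of `M`. -/
def resolutionOf [∀ i, Module.Projective A (P i)] (d : ∀ i, P (i + 1) →ₗ[A] P i)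
    (hd : ∀ i, d i ∘ₗ d (i + 1) = 0) (hex : ∀ i, Function.Exact (d (i + 1)) (d i))
    (p : P 0 →ₗ[A] M) (hp : Function.Surjective p) (hpex : Function.Exact (d 0) p) :
    ProjectiveResolution (ModuleCat.of A M) where
  complex := chainComplexOf d hd
  projective i := ModuleCat.projective_of_categoryTheory_projective (ModuleCat.of A (P i))
  π := (ChainComplex.toSingle₀Equiv (chainComplexOf d hd) (ModuleCat.of A M)).symm
    ⟨ModuleCat.ofHom p, by
      rw [chainComplexOf_d]
      ext z
      exact (hpex (d 0 z)).2 ⟨z, rfl⟩⟩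
  quasiIso := ⟨fun i => by
    cases i with
    | zero =>
      rw [ChainComplex.quasiIsoAt₀_iff, ShortComplex.quasiIso_iff_of_zeros' _ rfl rfl rfl]
      constructor
      · rw [ShortComplex.moduleCat_exact_iff]
        intro z hz
        obtain ⟨y, hy⟩ := (hpex z).1 (by simpa [ChainComplex.toSingle₀Equiv] using! hz)
        refine ⟨y, ?_⟩
        change (chainComplexOf d hd).d 1 0 y = z
        rw [chainComplexOf_d]
        exact hy
      · rw [ModuleCat.epi_iff_surjective]
        simpa [ChainComplex.toSingle₀Equiv] using! hp
    | succ i =>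
      rw [quasiIsoAt_iff_exactAt' (hL := ChainComplex.exactAt_succ_single_obj ..),
        HomologicalComplex.exactAt_iff' _ (i + 2) (i + 1) i (by simp) (by simp),
        ShortComplex.moduleCat_exact_iff]
      intro z hz
      change (chainComplexOf d hd).d (i + 1) i z = 0 at hz
      rw [chainComplexOf_d] at hz
      obtain ⟨y, hy⟩ := (hex i z).1 hz
      refine ⟨y, ?_⟩
      change (chainComplexOf d hd).d (i + 2) (i + 1) y = z
      rw [chainComplexOf_d]
      exact hy⟩

end Resolution

/-- As the outgoing map is zero, the homology is the cokernel of `S.f`; any element outside the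
image spans it. -/
theorem exists_smul_add_of_finrank_homology_eq_one {K : Type u} [Field K]
    (S : ShortComplex (ModuleCat.{u} K)) (hg : S.g = 0)
    (h : Module.finrank K S.homology = 1) :
    (∃ z : S.X₂, z ∉ LinearMap.range S.f.hom) ∧
    ∀ z₀ : S.X₂, z₀ ∉ LinearMap.range S.f.hom → ∀ z : S.X₂, ∃ (c : K) (y : S.X₁),
      z = c • z₀ + S.f.hom y := by
  have hs : LinearMap.ker S.g.hom = ⊤ := by rw [hg]; ext; simp
  have e : S.homology ≃ₗ[K] _ := (S.moduleCatHomologyIso).toLinearEquiv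
  rw [e.finrank_eq] at h
  change Module.finrank K (LinearMap.ker S.g.hom ⧸ LinearMap.range S.moduleCatToCycles) = 1 at h
  have mk_eq_zero : ∀ z : LinearMap.ker S.g.hom,
      (Submodule.Quotient.mk z : _ ⧸ LinearMap.range S.moduleCatToCycles) = 0 ↔
        (z : S.X₂) ∈ LinearMap.range S.f.hom := by
    intro z
    rw [Submodule.Quotient.mk_eq_zero]
    constructor
    · rintro ⟨y, rfl⟩
      exact ⟨y, rfl⟩
    · rintro ⟨y, hy⟩
      exact ⟨y, Subtype.ext hy⟩
  constructor
  · obtain ⟨v, hv, -⟩ := finrank_eq_one_iff'.1 h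
    obtain ⟨z, rfl⟩ := Submodule.Quotient.mk_surjective _ v
    exact ⟨z, fun hz => hv ((mk_eq_zero z).2 hz)⟩
  · intro z₀ hz₀ z
    let z₀' : LinearMap.ker S.g.hom := ⟨z₀, hs ▸ Submodule.mem_top⟩
    let z' : LinearMap.ker S.g.hom := ⟨z, hs ▸ Submodule.mem_top⟩
    obtain ⟨c, hc⟩ := exists_smul_eq_of_finrank_eq_one h
      (x := (Submodule.Quotient.mk z₀' : _ ⧸ LinearMap.range S.moduleCatToCycles))
      (fun h0 => hz₀ ((mk_eq_zero z₀').1 h0)) (Submodule.Quotient.mk z')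
    rw [← Submodule.Quotient.mk_smul, eq_comm, ← sub_eq_zero, ← Submodule.Quotient.mk_sub,
      mk_eq_zero] at hc
    obtain ⟨y, hy⟩ := hc
    refine ⟨c, y, ?_⟩
    rw [hy]
    change z = c • z₀ + (z - c • z₀)
    abel

/-! ### The conditions on dimension and Ext, restated for cocycles of an explicit resolution. -/

section Consequences

variable {A : Type u} [Ring A] {P : ℕ → Type u} [∀ i, AddCommGroup (P i)] [∀ i, Module A (P i)]
  {M : Type u} [AddCommGroup M] [Module A M] [∀ i, Module.Projective A (P i)]
  (d : ∀ i, P (i + 1) →ₗ[A] P i)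
  (hd : ∀ i, d i ∘ₗ d (i + 1) = 0) (hex : ∀ i, Function.Exact (d (i + 1)) (d i))
  (p : P 0 →ₗ[A] M) (hp : Function.Surjective p) (hpex : Function.Exact (d 0) p)
include hd hex hp hpex

theorem exists_comp_of_hasProjectiveDimensionLT {n : ℕ}
    (h : HasProjectiveDimensionLT (ModuleCat.of A M) (n + 1))
    {Y : Type u} [AddCommGroup Y] [Module A Y] (f : P (n + 1) →ₗ[A] Y)
    (hf : f ∘ₗ d (n + 1) = 0) : ∃ g : P n →ₗ[A] Y, g ∘ₗ d n = f := by
  let R := resolutionOf d hd hex p hp hpex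
  have hf' : R.complex.d (n + 2) (n + 1) ≫ (ModuleCat.ofHom f : R.complex.X (n + 1) ⟶ _) = 0 := by
    change (chainComplexOf d hd).d (n + 2) (n + 1) ≫ _ = 0
    rw [chainComplexOf_d]
    exact ModuleCat.hom_ext hf
  obtain ⟨g, hg⟩ := (R.extMk_eq_zero_iff _ (n + 2) rfl hf' n rfl).1
    (Abelian.Ext.eq_zero_of_hasProjectiveDimensionLT _ (n + 1) le_rfl)
  refine ⟨g.hom, ?_⟩
  change (chainComplexOf d hd).d (n + 1) n ≫ g = _ at hg
  rw [chainComplexOf_d] at hg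
  exact congrArg ModuleCat.Hom.hom hg

variable (K : Type u) [Field K] [Algebra K A] (Y : Type u) [AddCommGroup Y] [Module A Y]

theorem exists_comp_of_isZero_ext {n : ℕ}
    (h : Limits.IsZero (((Ext K (ModuleCat.{u} A) (n + 1)).obj
      (Opposite.op (ModuleCat.of A M))).obj (ModuleCat.of A Y))) (f : P (n + 1) →ₗ[A] Y)
    (hf : f ∘ₗ d (n + 1) = 0) : ∃ g : P n →ₗ[A] Y, g ∘ₗ d n = f := by
  let R := resolutionOf d hd hex p hp hpex
  have hz := h.of_iso (R.isoExt (n + 1) (ModuleCat.of A Y)).symm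
  rw [← HomologicalComplex.exactAt_iff_isZero_homology,
    HomologicalComplex.exactAt_iff' _ n (n + 1) (n + 2) (by simp) (by simp),
    ShortComplex.moduleCat_exact_iff] at hz
  obtain ⟨g, hg⟩ := hz (ModuleCat.ofHom f : R.complex.X (n + 1) ⟶ _) (by
    change (chainComplexOf d hd).d (n + 2) (n + 1) ≫ _ = 0
    rw [chainComplexOf_d]
    exact ModuleCat.hom_ext hf)
  change (chainComplexOf d hd).d (n + 1) n ≫ g = _ at hg
  rw [chainComplexOf_d] at hg
  exact ⟨ModuleCat.Hom.hom g, congrArg ModuleCat.Hom.hom hg⟩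

/-- When the next term of the resolution vanishes, every map out of `P (n + 1)` is a cocycle, so Ext
is the quotient of all such maps by the coboundaries. -/
theorem exists_smul_add_comp_of_finrank_ext_eq_one {n : ℕ}
    (h : Module.finrank K (((Ext K (ModuleCat.{u} A) (n + 1)).obj
      (Opposite.op (ModuleCat.of A M))).obj (ModuleCat.of A Y)) = 1)
    (h0 : Subsingleton (P (n + 2))) :
    (∃ f : P (n + 1) →ₗ[A] Y, ∀ g : P n →ₗ[A] Y, f ≠ g ∘ₗ d n) ∧
    ∀ f₀ : P (n + 1) →ₗ[A] Y, (∀ g : P n →ₗ[A] Y, f₀ ≠ g ∘ₗ d n) → ∀ f : P (n + 1) →ₗ[A] Y,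
      ∃ (c : K) (g : P n →ₗ[A] Y), ∀ z, f z = algebraMap K A c • f₀ z + g (d n z) := by
  let R := resolutionOf d hd hex p hp hpex
  let C := R.complex.linearYonedaObj K (ModuleCat.of A Y)
  rw [(R.isoExt (n + 1) (ModuleCat.of A Y)).toLinearEquiv.finrank_eq] at h
  have e : C.homology (n + 1) ≅ (C.sc' n (n + 1) (n + 2)).homology :=
    ShortComplex.homologyMapIso (C.isoSc' n (n + 1) (n + 2) (by simp) (by simp))
  rw [e.toLinearEquiv.finrank_eq] at h
  have hdef : ∀ g : P n →ₗ[A] Y, (C.sc' n (n + 1) (n + 2)).f.hom (ModuleCat.ofHom g) =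
      ModuleCat.ofHom (g ∘ₗ d n) := by
    intro g
    change (chainComplexOf d hd).d (n + 1) n ≫ (ModuleCat.ofHom g : _ ⟶ ModuleCat.of A Y) = _
    rw [chainComplexOf_d]
    rfl
  have key := exists_smul_add_of_finrank_homology_eq_one (C.sc' n (n + 1) (n + 2)) (by
    ext f
    change (chainComplexOf d hd).d (n + 2) (n + 1) ≫ (f : _ ⟶ ModuleCat.of A Y) = 0
    ext z
    rw [show z = 0 from h0.elim z 0]
    simp) h
  have nmem : ∀ f₀ : P (n + 1) →ₗ[A] Y,
      ((show (C.sc' n (n + 1) (n + 2)).X₂ from ModuleCat.ofHom f₀) ∉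
        LinearMap.range (C.sc' n (n + 1) (n + 2)).f.hom) ↔
      ∀ g : P n →ₗ[A] Y, f₀ ≠ g ∘ₗ d n := by
    intro f₀
    constructor
    · rintro h g rfl
      exact h ⟨_, hdef g⟩
    · rintro h ⟨g, hg⟩
      exact h (ModuleCat.Hom.hom g) (congrArg ModuleCat.Hom.hom (hg.symm.trans (hdef _)))
  constructor
  · obtain ⟨f, hf⟩ := key.1
    exact ⟨ModuleCat.Hom.hom f, (nmem (ModuleCat.Hom.hom f)).1 hf⟩
  · intro f₀ hf₀ f
    obtain ⟨c, g, hg⟩ := key.2 (ModuleCat.ofHom f₀) ((nmem f₀).2 hf₀) (ModuleCat.ofHom f)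
    refine ⟨c, ModuleCat.Hom.hom g, fun z => ?_⟩
    have := hg.trans (congrArg (_ + ·) (hdef (ModuleCat.Hom.hom g)))
    exact congrArg (fun F => (ModuleCat.Hom.hom F : P (n + 1) →ₗ[A] Y) z) this

end Consequences

/-! ### Elements of `A ⊗ V` as `A`-valued functions. -/

section Evaluation

variable {K A V X : Type*} [Field K] [Ring A] [Algebra K A] [AddCommGroup V] [Module K V]

/-- The `A`-linear extension `A ⊗ V → (X → A)` of a linear map `V → (X → K)`. -/
def evalTensor (A : Type*) [Ring A] [Algebra K A] (φ : V →ₗ[K] (X → K)) : A ⊗[K] V →ₗ[A] (X → A) :=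
  LinearMap.pi fun l => (TensorProduct.AlgebraTensorModule.rid K A A).toLinearMap ∘ₗ
    TensorProduct.AlgebraTensorModule.lTensor A A (LinearMap.proj l ∘ₗ φ)

@[simp]
theorem evalTensor_tmul (φ : V →ₗ[K] (X → K)) (a : A) (v : V) (l : X) :
    evalTensor A φ (a ⊗ₜ v) l = φ v l • a := by
  simp [evalTensor]

/-- A basis of `A` over `K` turns an element of `A ⊗ V` into a finite family of vectors of `V`, and
evaluation applies `φ` to each of them. No finiteness of `X` is needed. -/
theorem evalTensor_injective (φ : V →ₗ[K] (X → K)) (hφ : Function.Injective φ) :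
    Function.Injective (evalTensor A φ) := by
  rw [injective_iff_map_eq_zero]
  intro z hz
  classical
  let b := Module.Basis.ofVectorSpace K A
  apply (TensorProduct.equivFinsuppOfBasisLeft b).injective
  rw [map_zero]
  ext i
  apply hφ
  ext l
  have key : ∀ z : A ⊗[K] V,
      φ (TensorProduct.equivFinsuppOfBasisLeft b z i) l = b.repr (evalTensor A φ z l) i := by
    intro z
    induction z with
    | zero => simp
    | add z w hz hw => simp [hz, hw]
    | tmul a v => simp [mul_comm]
  rw [key, hz]
  simp

end Evaluation

/-! ### Tensors over `E` as functions on words. -/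

section Coordinates

variable {K E : Type u} [Field K] [AddCommGroup E] [Module K E] {N q : ℕ}
  (x : Module.Basis (Fin q) K E)

/-- The coordinates of a tensor of degree `n` in a basis of `E`, as a function on words which
vanishes on the words of length different from `n`. -/
def coord (n : ℕ) : ⨂[K]^n E →ₗ[K] (List (Fin q) → K) :=
  LinearMap.pi fun l => if h : l.length = n then
    (Basis.piTensorProduct (fun _ : Fin n => x)).coord (fun i => l.get (i.cast h.symm)) else 0

theorem coord_of_length_ne {n : ℕ} (t : ⨂[K]^n E) {l : List (Fin q)} (h : l.length ≠ n) :
    coord x n t l = 0 := by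
  simp [coord, h]

theorem coord_ofFn {n : ℕ} (t : ⨂[K]^n E) (u : Fin n → Fin q) :
    coord x n t (List.ofFn u) = (Basis.piTensorProduct (fun _ : Fin n => x)).repr t u := by
  simp [coord]

theorem coord_tprod_ofFn {n : ℕ} (v : Fin n → E) (u : Fin n → Fin q) :
    coord x n (PiTensorProduct.tprod K v) (List.ofFn u) = ∏ i, x.repr (v i) (u i) := by
  rw [coord_ofFn, Basis.piTensorProduct_repr_tprod_apply]

theorem exists_ofFn_eq {n : ℕ} {l : List (Fin q)} (h : l.length = n) :
    ∃ u : Fin n → Fin q, List.ofFn u = l := by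
  subst h
  exact ⟨l.get, List.ofFn_get l⟩

theorem coord_injective (n : ℕ) : Function.Injective (coord x n) := by
  intro s t h
  apply (Basis.piTensorProduct (fun _ : Fin n => x)).ext_elem
  intro u
  rw [← coord_ofFn, ← coord_ofFn, h]

theorem coord_tprod_basis {n : ℕ} (u : Fin n → Fin q) (l : List (Fin q)) :
    coord x n (PiTensorProduct.tprod K fun i => x (u i)) l = if l = List.ofFn u then 1 else 0 := by
  by_cases hl : l.length = n
  · obtain ⟨u', rfl⟩ := exists_ofFn_eq hl
    rw [coord_ofFn, ← Basis.piTensorProduct_apply, Module.Basis.repr_self, Finsupp.single_apply]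
    simp [List.ofFn_inj, eq_comm]
  · rw [coord_of_length_ne x _ hl, if_neg]
    rintro rfl
    simp at hl

theorem exists_coord_eq {n : ℕ} {f : List (Fin q) → K} (hf : ∀ l, l.length ≠ n → f l = 0) :
    ∃ t, coord x n t = f := by
  refine ⟨∑ u : Fin n → Fin q, f (List.ofFn u) • PiTensorProduct.tprod K fun i => x (u i), ?_⟩
  ext l
  by_cases hl : l.length = n
  · obtain ⟨u', rfl⟩ := exists_ofFn_eq hl
    simp [coord_tprod_basis, List.ofFn_inj]
  · rw [coord_of_length_ne x _ hl, hf l hl]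

theorem coord_mulEquiv {n m : ℕ} (a : ⨂[K]^n E) (b : ⨂[K]^m E) {l₁ : List (Fin q)}
    (h : l₁.length = n) (l₂ : List (Fin q)) :
    coord x (n + m) (TensorPower.mulEquiv (a ⊗ₜ b)) (l₁ ++ l₂) = coord x n a l₁ * coord x m b l₂ := by
  by_cases h₂ : l₂.length = m
  · obtain ⟨u, rfl⟩ := exists_ofFn_eq h
    obtain ⟨u', rfl⟩ := exists_ofFn_eq h₂
    induction a using PiTensorProduct.induction_on with
    | add a a' ha ha' => simp [TensorProduct.add_tmul, ha, ha', add_mul]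
    | smul_tprod c v =>
      induction b using PiTensorProduct.induction_on with
      | add b b' hb hb' => simp only [TensorProduct.tmul_add, map_add, Pi.add_apply, hb, hb', mul_add]
      | smul_tprod c' v' =>
        rw [TensorProduct.smul_tmul_smul, map_smul, map_smul, ← TensorPower.gMul_def,
          TensorPower.tprod_mul_tprod, ← List.ofFn_fin_append, map_smul, map_smul]
        simp only [Pi.smul_apply, coord_tprod_ofFn, Fin.prod_univ_add, Fin.append_left,
          Fin.append_right, smul_eq_mul]
        ring
  · rw [coord_of_length_ne x b h₂, coord_of_length_ne, mul_zero]
    simpa [h] using h₂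

theorem coord_cast {n m : ℕ} (h : n = m) (t : ⨂[K]^n E) :
    coord x m (TensorPower.cast K E h t) = coord x n t := by
  subst h
  simp

theorem coord_tprod_cons {n : ℕ} (v : Fin (n + 1) → E) (c : Fin q) (l : List (Fin q)) :
    coord x (n + 1) (PiTensorProduct.tprod K v) (c :: l) =
      x.repr (v 0) c * coord x n (PiTensorProduct.tprod K (Fin.tail v)) l := by
  by_cases h : l.length = n
  · obtain ⟨u, rfl⟩ := exists_ofFn_eq h
    have : c :: List.ofFn u = List.ofFn (Fin.cons c u : Fin (n + 1) → Fin q) := by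
      simp [List.ofFn_succ]
    rw [this, coord_tprod_ofFn, coord_tprod_ofFn, Fin.prod_univ_succ]
    simp [Fin.tail]
  · rw [coord_of_length_ne x _ h, coord_of_length_ne, mul_zero]
    simpa using h

/-- Membership can be tested by freezing the outer letters: each resulting middle function must be
the coordinates of a relation. -/
theorem mem_shiftedRelations_iff (R : Submodule K (⨂[K]^N E)) {n r s : ℕ} (h : r + N + s = n)
    (t : ⨂[K]^n E) : t ∈ shiftedRelations R r s h ↔
      ∀ l₁ l₂ : List (Fin q), l₁.length = r → l₂.length = s →
        (fun l => coord x n t (l₁ ++ l ++ l₂)) ∈ R.map (coord x N) := by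
  constructor
  · intro ht l₁ l₂ h₁ h₂
    induction ht using Submodule.span_induction with
    | zero => exact ⟨0, zero_mem _, by ext; simp⟩
    | add s t _ _ hs ht => simpa using! add_mem hs ht
    | smul c t _ ht => simpa using! Submodule.smul_mem _ c ht
    | mem t ht =>
      obtain ⟨a, ρ, b, hρ, rfl⟩ := ht
      refine ⟨(coord x r a l₁ * coord x s b l₂) • ρ, Submodule.smul_mem _ _ hρ, ?_⟩
      ext l
      rw [coord_cast]
      by_cases hl : l.length = N
      · rw [coord_mulEquiv x _ _ (by simp [h₁, hl]), coord_mulEquiv x _ _ h₁]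
        simp
        ring
      · rw [coord_of_length_ne x _ hl, coord_of_length_ne]
        simp only [List.length_append]
        omega
  · intro ht
    choose! ρ hρ hρ' using ht
    -- Expanding the two outer factors in the basis leaves the relation `ρ` as the middle
    -- coefficient.
    have : t = ∑ u₁ : Fin r → Fin q, ∑ u₂ : Fin s → Fin q,
        TensorPower.cast K E h (TensorPower.mulEquiv (TensorPower.mulEquiv
          ((PiTensorProduct.tprod K fun i => x (u₁ i)) ⊗ₜ[K] ρ (List.ofFn u₁) (List.ofFn u₂)) ⊗ₜ[K]
            (PiTensorProduct.tprod K fun i => x (u₂ i)))) := by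
      apply coord_injective x n
      ext l
      by_cases hl : l.length = n
      · obtain ⟨l₁, l₂, l₃, h₁, h₂, h₃, rfl⟩ : ∃ l₁ l₂ l₃ : List (Fin q), l₁.length = r ∧
            l₂.length = N ∧ l₃.length = s ∧ l₁ ++ l₂ ++ l₃ = l := by
          refine ⟨l.take r, (l.drop r).take N, (l.drop r).drop N, ?_, ?_, ?_, ?_⟩
          · simp; omega
          · simp; omega
          · simp; omega
          · rw [List.append_assoc, List.take_append_drop, List.take_append_drop]
        obtain ⟨u₁, rfl⟩ := exists_ofFn_eq h₁
        obtain ⟨u₃, rfl⟩ := exists_ofFn_eq h₃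
        have e := congrFun (hρ' (List.ofFn u₁) (List.ofFn u₃) h₁ h₃) l₂
        simp only [map_sum, Finset.sum_apply, coord_cast]
        simp only [coord_mulEquiv x _ _ (show (List.ofFn u₁ ++ l₂).length = r + N by simp [h₂]),
          coord_mulEquiv x _ _ h₁, coord_tprod_basis, List.ofFn_inj]
        simpa using e.symm
      · simp only [map_sum, Finset.sum_apply, coord_cast]
        simp [coord_of_length_ne x _ hl, coord_of_length_ne x _ (h ▸ hl)]
    rw [this]
    refine Submodule.sum_mem _ fun u₁ _ => Submodule.sum_mem _ fun u₂ _ => ?_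
    exact Submodule.subset_span ⟨_, _, _, hρ _ _ (by simp) (by simp), rfl⟩

/-- The coordinates of the elements of `(A^!_n)^*`. -/
def dualWords (R : Submodule K (⨂[K]^N E)) (n : ℕ) : Submodule K (List (Fin q) → K) :=
  (dualComponent R n).map (coord x n)

theorem mem_dualWords_iff (R : Submodule K (⨂[K]^N E)) {n : ℕ} {f : List (Fin q) → K} :
    f ∈ dualWords x R n ↔ (∀ l, l.length ≠ n → f l = 0) ∧
      ∀ l₁ l₂ : List (Fin q), l₁.length + N + l₂.length = n →
        (fun l => f (l₁ ++ l ++ l₂)) ∈ R.map (coord x N) := by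
  constructor
  · rintro ⟨t, ht, rfl⟩
    refine ⟨fun l hl => coord_of_length_ne x t hl, fun l₁ l₂ h => ?_⟩
    simp only [dualComponent, SetLike.mem_coe, Submodule.mem_iInf] at ht
    exact (mem_shiftedRelations_iff x R h t).1 (ht _ _ h) l₁ l₂ rfl rfl
  · rintro ⟨hf, hf'⟩
    obtain ⟨t, rfl⟩ := exists_coord_eq x hf
    refine ⟨t, ?_, rfl⟩
    simp only [dualComponent, SetLike.mem_coe, Submodule.mem_iInf]
    intro r s h
    rw [mem_shiftedRelations_iff x]
    rintro l₁ l₂ rfl rfl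
    exact hf' l₁ l₂ h

end Coordinates

/-! ### The Koszul differential on functions on words. -/

section Words

variable {A : Type*} [Ring A] {q : ℕ} (y : Fin q → A)

/-- The product in `A` of the generators `y` along a word. -/
def wordProd (l : List (Fin q)) : A := (l.map y).prod

@[simp]
theorem wordProd_nil : wordProd y [] = 1 := rfl

@[simp]
theorem wordProd_cons (c : Fin q) (l : List (Fin q)) :
    wordProd y (c :: l) = y c * wordProd y l := by
  simp [wordProd]

/-- The Koszul differential in coordinates: `F ↦ ∑_c F(c ·) y_c`. -/
def wordD : (List (Fin q) → A) →ₗ[A] (List (Fin q) → A) where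
  toFun F l := ∑ c, F (c :: l) * y c
  map_add' F G := by ext l; simp [add_mul, Finset.sum_add_distrib]
  map_smul' a F := by ext l; simp [Finset.mul_sum, mul_assoc]

theorem wordD_apply (F : List (Fin q) → A) (l : List (Fin q)) :
    wordD y F l = ∑ c, F (c :: l) * y c := rfl

theorem wordD_pow_apply (k : ℕ) (F : List (Fin q) → A) (l : List (Fin q)) :
    (wordD y ^ k) F l =
      ∑ u : Fin k → Fin q, F (List.ofFn u ++ l) * wordProd y (List.ofFn u) := by
  induction k generalizing F with
  | zero => simp
  | succ k ih =>
    rw [pow_succ, Module.End.mul_apply, ih, ← (Fin.consEquiv fun _ => Fin q).sum_comp,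
      Fintype.sum_prod_type_right]
    refine Finset.sum_congr rfl fun u _ => ?_
    rw [wordD_apply, Finset.sum_mul]
    refine Finset.sum_congr rfl fun c _ => ?_
    simp [Fin.consEquiv, List.ofFn_succ, mul_assoc]

end Words

/-! ### Transport of the Koszul complex to word coordinates. -/

section Generators

variable {K E : Type u} [Field K] [AddCommGroup E] [Module K E] {N q : ℕ}
  (x : Module.Basis (Fin q) K E) (R : Submodule K (⨂[K]^N E))

/-- The images in `A(E, R)` of the elements of a basis of `E`. -/
def basisGen (c : Fin q) : Alg R := gen R (x c)

theorem ofPower_tprod {n : ℕ} (v : Fin n → E) :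
    ofPower R n (PiTensorProduct.tprod K v) = (List.ofFn fun i => gen R (v i)).prod := by
  simp only [ofPower, LinearMap.comp_apply, TensorPower.toTensorAlgebra_tprod,
    TensorAlgebra.tprod_apply, AlgHom.toLinearMap_apply, map_list_prod, List.map_ofFn]
  rfl

theorem ofPower_eq_sum {n : ℕ} (t : ⨂[K]^n E) :
    ofPower R n t = ∑ u : Fin n → Fin q,
      coord x n t (List.ofFn u) • wordProd (basisGen x R) (List.ofFn u) := by
  conv_lhs => rw [← (Basis.piTensorProduct (fun _ : Fin n => x)).sum_repr t]
  rw [map_sum]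
  refine Finset.sum_congr rfl fun u _ => ?_
  rw [map_smul, coord_ofFn, Basis.piTensorProduct_apply, ofPower_tprod, wordProd, List.map_ofFn]
  rfl

theorem ofPower_of_mem {ρ : ⨂[K]^N E} (hρ : ρ ∈ R) : ofPower R N ρ = 0 := by
  have := RingQuot.mkAlgHom_rel K (Rel.of ρ hρ)
  simpa [ofPower] using this

theorem sum_smul_wordProd_of_mem {f : List (Fin q) → K} (hf : f ∈ R.map (coord x N)) :
    ∑ u : Fin N → Fin q, f (List.ofFn u) • wordProd (basisGen x R) (List.ofFn u) = 0 := by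
  obtain ⟨ρ, hρ, rfl⟩ := hf
  rw [← ofPower_eq_sum, ofPower_of_mem R hρ]

theorem gen_eq_sum (v : E) : gen R v = ∑ c, x.repr v c • basisGen x R c := by
  conv_lhs => rw [← x.sum_repr v]
  simp only [map_sum, map_smul, basisGen]

theorem evalTensor_koszulD (n : ℕ) (z : Alg R ⊗[K] ⨂[K]^(n + 1) E) :
    evalTensor (Alg R) (coord x n) (koszulD R n z) =
      wordD (basisGen x R) (evalTensor (Alg R) (coord x (n + 1)) z) := by
  induction z with
  | zero => simp
  | add z w hz hw => simp [hz, hw]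
  | tmul a t =>
    induction t using PiTensorProduct.induction_on with
    | add s t hs ht => simp only [TensorProduct.tmul_add, map_add, hs, ht]
    | smul_tprod c v =>
      rw [← TensorProduct.smul_tmul]
      ext l
      simp only [koszulD_tmul_tprod, wordD_apply, evalTensor_tmul, coord_tprod_cons]
      rw [gen_eq_sum x R (v 0), Finset.mul_sum, Finset.smul_sum]
      refine Finset.sum_congr rfl fun c _ => ?_
      rw [mul_smul_comm, smul_smul, smul_mul_assoc, mul_comm, smul_mul_assoc, smul_mul_assoc]

theorem evalTensor_koszulDPow (n k : ℕ) (z : Alg R ⊗[K] ⨂[K]^(n + k) E) :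
    evalTensor (Alg R) (coord x n) (koszulDPow R n k z) =
      (wordD (basisGen x R) ^ k) (evalTensor (Alg R) (coord x (n + k)) z) := by
  induction k with
  | zero => simp [koszulDPow]
  | succ k ih => rw [koszulDPow, LinearMap.comp_apply, ih, pow_succ, Module.End.mul_apply,
      evalTensor_koszulD]; rfl

/-- The term `A ⊗ (A^!_n)^*` of the Koszul `N`-complex, in coordinates. -/
def koszulWords (n : ℕ) : Submodule (Alg R) (List (Fin q) → Alg R) :=
  LinearMap.range (evalTensor (Alg R) (dualWords x R n).subtype)

theorem mem_koszulWords_iff {n : ℕ} {F : List (Fin q) → Alg R} :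
    F ∈ koszulWords x R n ↔
      ∃ z ∈ koszulTerm R n, evalTensor (Alg R) (coord x n) z = F := by
  constructor
  · rintro ⟨z, rfl⟩
    induction z with
    | zero => exact ⟨0, zero_mem _, by simp⟩
    | add z w hz hw =>
      obtain ⟨z', hz', ez⟩ := hz
      obtain ⟨w', hw', ew⟩ := hw
      exact ⟨z' + w', add_mem hz' hw', by rw [map_add, map_add, ez, ew]⟩
    | tmul a f =>
      obtain ⟨_, t, ht, rfl⟩ := f
      exact ⟨a ⊗ₜ t, ⟨a ⊗ₜ ⟨t, ht⟩, by simp⟩, by ext; simp⟩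
  · rintro ⟨_, ⟨z, rfl⟩, rfl⟩
    induction z with
    | zero => simp
    | add z w hz hw => simpa using! add_mem hz hw
    | tmul a t => exact ⟨a ⊗ₜ ⟨_, t.1, t.2, rfl⟩, by ext; simp⟩

theorem IsKoszul.exists_wordD_pow_eq {R : Submodule K (⨂[K]^N E)} (h : IsKoszul R) (k : ℕ)
    {F : List (Fin q) → Alg R} (hF : F ∈ koszulWords x R (N * k + 1))
    (hd : wordD (basisGen x R) F = 0) :
    ∃ G ∈ koszulWords x R (N * k + 1 + (N - 1)), (wordD (basisGen x R) ^ (N - 1)) G = F := by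
  obtain ⟨z, hz, rfl⟩ := (mem_koszulWords_iff x R).1 hF
  rw [← evalTensor_koszulD] at hd
  obtain ⟨y, hy, rfl⟩ := h.exact_odd k z hz
    (evalTensor_injective _ (coord_injective x _) (by rw [hd, map_zero]))
  exact ⟨_, (mem_koszulWords_iff x R).2 ⟨y, hy, rfl⟩, (evalTensor_koszulDPow x R _ _ y).symm⟩

theorem IsKoszul.exists_wordD_eq {R : Submodule K (⨂[K]^N E)} (h : IsKoszul R) (k : ℕ)
    {F : List (Fin q) → Alg R} (hF : F ∈ koszulWords x R (N * k + 1 + (N - 1)))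
    (hd : (wordD (basisGen x R) ^ (N - 1)) F = 0) :
    ∃ G ∈ koszulWords x R (N * k + 1 + (N - 1) + 1), wordD (basisGen x R) G = F := by
  obtain ⟨z, hz, rfl⟩ := (mem_koszulWords_iff x R).1 hF
  rw [← evalTensor_koszulDPow] at hd
  obtain ⟨y, hy, rfl⟩ := h.exact_even k z hz
    (evalTensor_injective _ (coord_injective x _) (by rw [hd, map_zero]))
  exact ⟨_, (mem_koszulWords_iff x R).2 ⟨y, hy, rfl⟩, (evalTensor_koszulD x R _ y).symm⟩

end Generators

/-! ### Coefficients of elements of `A` in degrees below `N`. -/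

section Truncation

variable {K E : Type u} [Field K] [AddCommGroup E] [Module K E] {N q : ℕ}
  (x : Module.Basis (Fin q) K E)

/-- Left multiplication by `v` in the tensor algebra truncated in degrees `≥ N`, where tensors are
represented by their coordinates. -/
def truncMul (N : ℕ) : E →ₗ[K] Module.End K (List (Fin q) → K) where
  toFun v :=
    { toFun := fun f l => match l with
        | [] => 0
        | c :: l => if l.length + 1 < N then x.repr v c * f l else 0
      map_add' := fun f g => by ext (_ | ⟨c, l⟩) <;> simp [mul_add, ite_add_zero]
      map_smul' := fun a f => by ext (_ | ⟨c, l⟩) <;> simp [mul_left_comm] }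
  map_add' v w := by ext f (_ | ⟨c, l⟩) <;> simp [add_mul, ite_add_zero]
  map_smul' a v := by ext f (_ | ⟨c, l⟩) <;> simp [mul_assoc]

theorem truncMul_cons (v : E) (f : List (Fin q) → K) (c : Fin q) (l : List (Fin q)) :
    truncMul x N v f (c :: l) = if l.length + 1 < N then x.repr v c * f l else 0 := rfl

theorem prod_truncMul_of_length_lt (f : List (Fin q) → K) (vs : List E) {l : List (Fin q)}
    (h : l.length < vs.length) : (vs.map (truncMul x N)).prod f l = 0 := by
  induction vs generalizing l with
  | nil => simp at h
  | cons v vs ih =>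
    rw [List.map_cons, List.prod_cons, Module.End.mul_apply]
    cases l with
    | nil => rfl
    | cons c l => simp [truncMul_cons, ih (by simpa using h)]

/-- Together with `prod_truncMul_of_length_lt`, this makes any product of `N` operators vanish, so
the truncated action respects every `R` in degree `N`. -/
theorem prod_truncMul_of_le_length (f : List (Fin q) → K) {vs : List E} (hvs : vs ≠ [])
    {l : List (Fin q)} (h : N ≤ l.length) : (vs.map (truncMul x N)).prod f l = 0 := by
  obtain ⟨v, vs, rfl⟩ := List.exists_cons_of_ne_nil hvs
  rw [List.map_cons, List.prod_cons, Module.End.mul_apply]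
  cases l with
  | nil => rfl
  | cons c l => simp [truncMul_cons, Nat.not_lt.2 (by simpa using h)]

theorem prod_truncMul_basis (f : List (Fin q) → K) {u l : List (Fin q)}
    (h : l.length = u.length) (hl : l.length < N) :
    ((u.map x).map (truncMul x N)).prod f l = if l = u then f [] else 0 := by
  induction u generalizing l with
  | nil => simp [List.length_eq_zero_iff.1 h]
  | cons c u ih =>
    rw [List.map_cons, List.map_cons, List.prod_cons, Module.End.mul_apply]
    cases l with
    | nil => simp at h
    | cons c' l =>
      rw [truncMul_cons, if_pos (by simpa using hl), ih (by simpa using h) (by simp at hl; omega)]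
      simp only [Module.Basis.repr_self, Finsupp.single_apply, List.cons.injEq, ite_and, mul_ite,
        ite_mul, one_mul, zero_mul, mul_zero, eq_comm (a := c)]
      split_ifs <;> rfl

variable (R : Submodule K (⨂[K]^N E)) (hN : 1 ≤ N)

theorem lift_toTensorAlgebra_eq_zero {B : Type*} [Ring B] [Algebra K B] (φ : E →ₗ[K] B)
    (h : ∀ v : Fin N → E, (List.ofFn fun i => φ (v i)).prod = 0) (t : ⨂[K]^N E) :
    TensorAlgebra.lift K φ (TensorPower.toTensorAlgebra t) = 0 := by
  induction t using PiTensorProduct.induction_on with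
  | add s t hs ht => simp [hs, ht]
  | smul_tprod c v =>
    rw [map_smul, map_smul, TensorPower.toTensorAlgebra_tprod, TensorAlgebra.tprod_apply,
      map_list_prod, List.map_ofFn]
    simp [Function.comp_def, h]

/-- The algebra homomorphism out of `A(E, R)` induced by a linear map on `E` that kills all
products of `N` elements. -/
def liftOfProdEqZero {B : Type*} [Ring B] [Algebra K B] (φ : E →ₗ[K] B)
    (h : ∀ v : Fin N → E, (List.ofFn fun i => φ (v i)).prod = 0) : Alg R →ₐ[K] B :=
  RingQuot.liftAlgHom K ⟨TensorAlgebra.lift K φ, by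
    rintro _ _ ⟨r, -⟩
    rw [lift_toTensorAlgebra_eq_zero φ h, map_zero]⟩

theorem liftOfProdEqZero_gen {B : Type*} [Ring B] [Algebra K B] (φ : E →ₗ[K] B)
    (h : ∀ v : Fin N → E, (List.ofFn fun i => φ (v i)).prod = 0) (v : E) :
    liftOfProdEqZero R φ h (gen R v) = φ v := by
  simp [liftOfProdEqZero, gen]

/-- The augmentation of `A(E, R)`. -/
def augmentation : Alg R →ₐ[K] K :=
  liftOfProdEqZero R 0 fun v => by
    obtain ⟨n, rfl⟩ := Nat.exists_eq_add_of_le' hN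
    simp [List.ofFn_succ]

@[simp]
theorem augmentation_gen (v : E) : augmentation R hN (gen R v) = 0 :=
  liftOfProdEqZero_gen ..

/-- The action of `A(E, R)` on the tensor algebra truncated in degrees `≥ N`. -/
def truncAction : Alg R →ₐ[K] Module.End K (List (Fin q) → K) :=
  liftOfProdEqZero R (truncMul x N) fun v => by
    ext f l
    rw [show (List.ofFn fun i => truncMul x N (v i)) = (List.ofFn v).map (truncMul x N) by
      rw [List.map_ofFn]; rfl]
    rcases lt_or_ge l.length N with h | h
    · exact prod_truncMul_of_length_lt x f _ (by simpa using h)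
    · refine prod_truncMul_of_le_length x f ?_ h
      rw [Ne, List.ofFn_eq_nil_iff]
      omega

theorem truncAction_wordProd (u : List (Fin q)) :
    truncAction x R hN (wordProd (basisGen x R) u) = ((u.map x).map (truncMul x N)).prod := by
  rw [wordProd, map_list_prod, List.map_map, List.map_map]
  congr 2
  ext1 c
  exact liftOfProdEqZero_gen ..

theorem gen_induction {p : Alg R → Prop} (hK : ∀ c : K, p (algebraMap K (Alg R) c))
    (hgen : ∀ v, p (gen R v)) (hmul : ∀ a b, p a → p b → p (a * b))
    (hadd : ∀ a b, p a → p b → p (a + b)) (a : Alg R) : p a := by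
  obtain ⟨t, rfl⟩ := RingQuot.mkAlgHom_surjective K (Rel R) a
  induction t using TensorAlgebra.induction with
  | algebraMap c => rw [AlgHom.commutes]; exact hK c
  | ι v => exact hgen v
  | mul a b ha hb => rw [map_mul]; exact hmul _ _ ha hb
  | add a b ha hb => rw [map_add]; exact hadd _ _ ha hb

theorem truncAction_apply_nil (a : Alg R) (f : List (Fin q) → K) :
    truncAction x R hN a f [] = augmentation R hN a * f [] := by
  induction a using gen_induction generalizing f with
  | hK c => simp
  | hgen v => rw [augmentation_gen, zero_mul, truncAction, liftOfProdEqZero_gen]; rfl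
  | hmul a b ha hb => rw [map_mul, Module.End.mul_apply, ha, hb, map_mul, mul_assoc]
  | hadd a b ha hb => rw [map_add, LinearMap.add_apply, Pi.add_apply, ha, hb, map_add, add_mul]

/-- The coordinates of the homogeneous components of degrees `< N` of an element of `A(E, R)`. -/
def lowCoeff : Alg R →ₗ[K] (List (Fin q) → K) :=
  LinearMap.applyₗ (Pi.single [] 1) ∘ₗ (truncAction x R hN).toLinearMap

/-- This substitutes for the grading of `A`: left multiplication by `x^u` raises degree by the
length of `u`, so coefficients up to that degree see only the constant term of `b`. -/
theorem lowCoeff_wordProd_mul {u l : List (Fin q)} (h : l.length ≤ u.length) (hl : l.length < N)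
    (b : Alg R) : lowCoeff x R hN (wordProd (basisGen x R) u * b) l =
      if l = u then augmentation R hN b else 0 := by
  change truncAction x R hN (_ * _) _ _ = _
  rw [map_mul, Module.End.mul_apply, truncAction_wordProd]
  rcases h.lt_or_eq with h | h
  · rw [prod_truncMul_of_length_lt x _ _ (by simpa using h), if_neg]
    rintro rfl
    exact h.ne rfl
  · rw [prod_truncMul_basis x _ h hl, truncAction_apply_nil]
    simp

theorem lowCoeff_wordProd {u l : List (Fin q)} (h : l.length ≤ u.length) (hl : l.length < N) :
    lowCoeff x R hN (wordProd (basisGen x R) u) l = if l = u then 1 else 0 := by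
  simpa using lowCoeff_wordProd_mul x R hN h hl 1

theorem basisGen_linearIndependent (h : 2 ≤ N) : LinearIndependent K (basisGen x R) := by
  have hN : 1 ≤ N := by omega
  rw [Fintype.linearIndependent_iff]
  intro c hc i
  have := congrArg (fun a => lowCoeff x R hN a [i]) hc
  simp only [map_sum, map_smul, Finset.sum_apply, Pi.smul_apply, map_zero, Pi.zero_apply] at this
  rw [← this]
  have key : ∀ j, lowCoeff x R hN (basisGen x R j) [i] = if i = j then 1 else 0 := by
    intro j
    simpa using lowCoeff_wordProd x R hN (u := [j]) (l := [i]) le_rfl (by simp; omega)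
  simp [key]

theorem finrank_component_one (x : Module.Basis (Fin q) K E) (R : Submodule K (⨂[K]^N E))
    (h : 2 ≤ N) : Module.finrank K (component R 1) = q := by
  have : component R 1 = Submodule.span K (Set.range (basisGen x R)) := by
    apply le_antisymm
    · rintro _ ⟨t, rfl⟩
      rw [ofPower_eq_sum x]
      refine sum_mem fun u _ => Submodule.smul_mem _ _ (Submodule.subset_span ⟨u 0, ?_⟩)
      simp
    · rw [Submodule.span_le]
      rintro _ ⟨c, rfl⟩
      exact ⟨PiTensorProduct.tprod K fun _ => x c, by simp [ofPower_tprod, basisGen]⟩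
  rw [this, finrank_span_eq_card (basisGen_linearIndependent x R h), Fintype.card_fin]

end Truncation

/-! ### The Koszul complex as a free resolution of the trivial module. -/

section KoszulResolution

variable {K E : Type u} [Field K] [AddCommGroup E] [Module K E] {N q : ℕ}
  (x : Module.Basis (Fin q) K E) (R : Submodule K (⨂[K]^N E))

theorem slice_left_mem_dualWords {n k : ℕ} {f : List (Fin q) → K} (hf : f ∈ dualWords x R (n + k))
    {u : List (Fin q)} (hu : u.length = k) : (fun l => f (u ++ l)) ∈ dualWords x R n := by
  rw [mem_dualWords_iff] at hf ⊢
  refine ⟨fun l hl => hf.1 _ (by simp; omega), fun l₁ l₂ h => ?_⟩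
  have := hf.2 (u ++ l₁) l₂ (by simp; omega)
  simpa [List.append_assoc] using this

theorem slice_right_mem_dualWords {n k : ℕ} {f : List (Fin q) → K}
    (hf : f ∈ dualWords x R (n + k)) {u : List (Fin q)} (hu : u.length = k) :
    (fun l => f (l ++ u)) ∈ dualWords x R n := by
  rw [mem_dualWords_iff] at hf ⊢
  refine ⟨fun l hl => hf.1 _ (by simp; omega), fun l₁ l₂ h => ?_⟩
  have := hf.2 l₁ (l₂ ++ u) (by simp; omega)
  simpa [List.append_assoc] using this

/-- The contraction of the elements of `(A^!_{n + k})^*` with a word of length `k`, on the left. -/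
def slice (n : ℕ) {k : ℕ} (u : Fin k → Fin q) : dualWords x R (n + k) →ₗ[K] dualWords x R n where
  toFun f := ⟨fun l => f.1 (List.ofFn u ++ l), slice_left_mem_dualWords x R f.2 (by simp)⟩
  map_add' f g := rfl
  map_smul' c f := rfl

@[simp]
theorem slice_coe_apply (n : ℕ) {k : ℕ} (u : Fin k → Fin q) (f : dualWords x R (n + k))
    (l : List (Fin q)) : (slice x R n u f).1 l = f.1 (List.ofFn u ++ l) := rfl

/-- The freeness of the terms of the Koszul complex. -/
def koszulEquiv (n : ℕ) : Alg R ⊗[K] dualWords x R n ≃ₗ[Alg R] koszulWords x R n :=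
  LinearEquiv.ofInjective _ (evalTensor_injective _ (Submodule.injective_subtype _))

instance (n : ℕ) : Module.Projective (Alg R) (koszulWords x R n) :=
  Module.Projective.of_equiv (koszulEquiv x R n)

/-- The inclusion `(A^!_n)^* → A ⊗ (A^!_n)^*`. -/
def toKoszul (n : ℕ) (f : dualWords x R n) : koszulWords x R n := koszulEquiv x R n (1 ⊗ₜ f)

theorem toKoszul_coe_apply (n : ℕ) (f : dualWords x R n) (l : List (Fin q)) :
    (toKoszul x R n f).1 l = algebraMap K (Alg R) (f.1 l) := by
  change evalTensor _ _ _ _ = _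
  rw [evalTensor_tmul, Algebra.algebraMap_eq_smul_one]
  rfl

theorem koszulWords_induction {n : ℕ} {p : koszulWords x R n → Prop} (h0 : p 0)
    (hadd : ∀ F G, p F → p G → p (F + G)) (hsmul : ∀ (a : Alg R) f, p (a • toKoszul x R n f))
    (F : koszulWords x R n) : p F := by
  obtain ⟨z, rfl⟩ := (koszulEquiv x R n).surjective F
  induction z with
  | zero => simpa using h0
  | add z w hz hw => rw [map_add]; exact hadd _ _ hz hw
  | tmul a f =>
    rw [show a ⊗ₜ[K] f = a • ((1 : Alg R) ⊗ₜ[K] f) by rw [TensorProduct.smul_tmul']; simp, map_smul]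
    exact hsmul a f

/-- The `A`-linear extension to `A ⊗ (A^!_n)^*` of a `K`-linear map on `(A^!_n)^*`. -/
def koszulLift {Y : Type*} [AddCommGroup Y] [Module K Y] [Module (Alg R) Y]
    [IsScalarTower K (Alg R) Y] {n : ℕ} (f : dualWords x R n →ₗ[K] Y) :
    koszulWords x R n →ₗ[Alg R] Y :=
  TensorProduct.AlgebraTensorModule.lift
    (LinearMap.toSpanSingleton (Alg R) (dualWords x R n →ₗ[K] Y) f) ∘ₗ
      (koszulEquiv x R n).symm.toLinearMap

theorem koszulLift_toKoszul {Y : Type*} [AddCommGroup Y] [Module K Y] [Module (Alg R) Y]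
    [IsScalarTower K (Alg R) Y] {n : ℕ} (f : dualWords x R n →ₗ[K] Y) (t : dualWords x R n) :
    koszulLift x R f (toKoszul x R n t) = f t := by
  simp [koszulLift, toKoszul]

theorem koszulWords_apply_eq_zero {n : ℕ} (F : koszulWords x R n) {l : List (Fin q)}
    (hl : l.length ≠ n) : F.1 l = 0 := by
  induction F using koszulWords_induction with
  | h0 => rfl
  | hadd F G hF hG => exact (congrArg₂ (· + ·) hF hG).trans (add_zero 0)
  | hsmul a f =>
    change a • (toKoszul x R n f).1 l = 0
    rw [toKoszul_coe_apply, ((mem_dualWords_iff x R).1 f.2).1 l hl, map_zero, smul_zero]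

theorem wordD_pow_toKoszul {n k : ℕ} (f : dualWords x R (n + k)) :
    (wordD (basisGen x R) ^ k) (toKoszul x R (n + k) f).1 =
      (∑ u : Fin k → Fin q, wordProd (basisGen x R) (List.ofFn u) •
        toKoszul x R n (slice x R n u f) : koszulWords x R n).1 := by
  ext l
  simp only [wordD_pow_apply, toKoszul_coe_apply, Submodule.coe_sum, Finset.sum_apply,
    Submodule.coe_smul, Pi.smul_apply, smul_eq_mul, slice_coe_apply]
  exact Finset.sum_congr rfl fun u _ => Algebra.commutes _ _

theorem wordD_pow_mem_koszulWords {n k : ℕ} (F : koszulWords x R (n + k)) :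
    (wordD (basisGen x R) ^ k) F.1 ∈ koszulWords x R n := by
  induction F using koszulWords_induction with
  | h0 => simp
  | hadd F G hF hG => rw [Submodule.coe_add, map_add]; exact add_mem hF hG
  | hsmul a f =>
    rw [Submodule.coe_smul, map_smul, wordD_pow_toKoszul]
    exact Submodule.smul_mem _ _ (Subtype.prop _)

theorem wordD_pow_eq_zero {n : ℕ} (F : koszulWords x R (n + N)) :
    (wordD (basisGen x R) ^ N) F.1 = 0 := by
  induction F using koszulWords_induction with
  | h0 => simp
  | hadd F G hF hG => rw [Submodule.coe_add, map_add, hF, hG, add_zero]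
  | hsmul a f =>
    rw [Submodule.coe_smul, map_smul]
    convert smul_zero a
    ext l
    simp only [wordD_pow_apply, toKoszul_coe_apply, ← Algebra.smul_def]
    obtain ⟨h₁, h₂⟩ := (mem_dualWords_iff x R).1 f.2
    by_cases hl : l.length = n
    -- Here `d^N = 0`: the first `N` letters of an element of the dual component form a relation.
    · exact sum_smul_wordProd_of_mem x R (f := fun l' => f.1 (l' ++ l)) (h₂ [] l (by simp; omega))
    · refine Finset.sum_eq_zero fun u _ => ?_
      rw [h₁ _ (by simp; omega), zero_smul]

/-- The degree by which the `i`-th differential of the Koszul complex lowers the tensor degree. -/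
def koszulStep (N i : ℕ) : ℕ := if Even i then 1 else N - 1

/-- The tensor degree of the `i`-th term of the Koszul complex: `Nk` for `i = 2k` and `Nk + 1` for
`i = 2k + 1`. -/
def koszulDegree (N : ℕ) : ℕ → ℕ
  | 0 => 0
  | i + 1 => koszulDegree N i + koszulStep N i

theorem koszulStep_add_koszulStep (hN : 1 ≤ N) (i : ℕ) :
    koszulStep N i + koszulStep N (i + 1) = N := by
  rcases Nat.even_or_odd i with h | h
  · simp [koszulStep, h, Nat.even_add_one]
    omega
  · simp [koszulStep, Nat.not_even_iff_odd.2 h, Nat.even_add_one]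
    omega

theorem koszulDegree_two_mul (hN : 1 ≤ N) (k : ℕ) : koszulDegree N (2 * k) = N * k := by
  induction k with
  | zero => rfl
  | succ k ih =>
    change koszulDegree N (2 * k) + koszulStep N (2 * k) + koszulStep N (2 * k + 1) = _
    rw [add_assoc, koszulStep_add_koszulStep hN, ih, mul_add, mul_one]

theorem koszulDegree_two_mul_add_one (hN : 1 ≤ N) (k : ℕ) :
    koszulDegree N (2 * k + 1) = N * k + 1 := by
  rw [koszulDegree, koszulDegree_two_mul hN, koszulStep, if_pos (even_two_mul k)]

/-- The differentials of the Koszul complex. -/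
def koszulMap (i : ℕ) :
    koszulWords x R (koszulDegree N (i + 1)) →ₗ[Alg R] koszulWords x R (koszulDegree N i) :=
  (wordD (basisGen x R) ^ koszulStep N i).restrict fun F hF =>
    wordD_pow_mem_koszulWords x R (n := koszulDegree N i) ⟨F, hF⟩

theorem koszulMap_toKoszul (i : ℕ) (f : dualWords x R (koszulDegree N (i + 1))) :
    koszulMap x R i (toKoszul x R _ f) =
      ∑ u : Fin (koszulStep N i) → Fin q, wordProd (basisGen x R) (List.ofFn u) •
        toKoszul x R _ (slice x R (koszulDegree N i) u f) :=
  Subtype.ext (wordD_pow_toKoszul x R (n := koszulDegree N i) f)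

theorem koszulMap_comp_koszulMap (hN : 1 ≤ N) (i : ℕ) :
    koszulMap x R i ∘ₗ koszulMap x R (i + 1) = 0 := by
  have key : ∀ m, m = koszulDegree N i + N → ∀ F : koszulWords x R m,
      (wordD (basisGen x R) ^ N) F.1 = 0 := by
    rintro _ rfl
    exact wordD_pow_eq_zero x R
  ext1 F
  apply Subtype.ext
  change (wordD (basisGen x R) ^ koszulStep N i)
    ((wordD (basisGen x R) ^ koszulStep N (i + 1)) F.1) = 0
  rw [← Module.End.mul_apply, ← pow_add, koszulStep_add_koszulStep hN]
  exact key _ (by rw [koszulDegree, koszulDegree, add_assoc, koszulStep_add_koszulStep hN]) F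

theorem koszulMap_exact {R : Submodule K (⨂[K]^N E)} (h : IsKoszul R) (hN : 1 ≤ N) (i : ℕ) :
    Function.Exact (koszulMap x R (i + 1)) (koszulMap x R i) := by
  rw [LinearMap.exact_iff]
  refine le_antisymm ?_ ?_
  · rintro ⟨F, hF⟩ hd
    have hd : (wordD (basisGen x R) ^ koszulStep N i) F = 0 := congrArg Subtype.val hd
    suffices ∃ G ∈ koszulWords x R (koszulDegree N (i + 2)),
        (wordD (basisGen x R) ^ koszulStep N (i + 1)) G = F by
      obtain ⟨G, hG, rfl⟩ := this
      exact ⟨⟨G, hG⟩, rfl⟩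
    obtain ⟨k, rfl | rfl⟩ := Nat.even_or_odd' i
    · rw [koszulDegree, koszulDegree_two_mul_add_one hN]
      rw [koszulDegree_two_mul_add_one hN] at hF
      simp only [koszulStep, even_two_mul, if_true, pow_one, Nat.even_add_one, not_true,
        if_false] at hd ⊢
      exact h.exists_wordD_pow_eq x k hF hd
    · have e : koszulDegree N (2 * k + 1 + 1) = N * k + 1 + (N - 1) := by
        rw [koszulDegree, koszulDegree_two_mul_add_one hN]
        simp [koszulStep]
      rw [koszulDegree, e]
      rw [e] at hF
      simp only [koszulStep, even_two_mul, if_true, pow_one, Nat.even_add_one, not_true,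
        if_false, not_false_eq_true] at hd ⊢
      exact h.exists_wordD_eq x k hF hd
  · rintro _ ⟨F, rfl⟩
    exact LinearMap.congr_fun (koszulMap_comp_koszulMap x R hN i) F

/-- The augmentation ideal, as a left ideal. -/
abbrev augmentationIdeal : Ideal (Alg R) := Ideal.span (Set.range (gen R))

theorem mem_augmentationIdeal_iff (hN : 1 ≤ N) {a : Alg R} :
    a ∈ augmentationIdeal R ↔ augmentation R hN a = 0 := by
  constructor
  · intro ha
    have : augmentationIdeal R ≤ RingHom.ker (augmentation R hN) := by
      rw [Ideal.span_le]
      rintro _ ⟨v, rfl⟩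
      exact augmentation_gen R hN v
    exact this ha
  · intro ha
    have : ∀ a : Alg R, a - algebraMap K _ (augmentation R hN a) ∈ augmentationIdeal R := by
      intro a
      induction a using gen_induction with
      | hK c => simp
      | hgen v => rw [augmentation_gen, map_zero, sub_zero]; exact Ideal.subset_span ⟨v, rfl⟩
      | hmul a b ha hb =>
        -- The ideal is only a left ideal, so the product is split with both differences as
        -- right-hand factors; the scalar of `b` is central.
        have : a * b - algebraMap K _ (augmentation R hN (a * b)) =
            a * (b - algebraMap K _ (augmentation R hN b)) + algebraMap K _ (augmentation R hN b) *
              (a - algebraMap K _ (augmentation R hN a)) := by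
          rw [mul_sub, mul_sub, ← Algebra.commutes (augmentation R hN b) a, map_mul, mul_comm,
            map_mul]
          abel
        rw [this]
        exact add_mem (Ideal.mul_mem_left _ _ hb) (Ideal.mul_mem_left _ _ ha)
      | hadd a b ha hb =>
        rw [map_add, map_add, add_sub_add_comm]
        exact add_mem ha hb
    simpa [ha] using this a

theorem smul_quotient_augmentationIdeal (hN : 1 ≤ N) (a : Alg R) (y : Alg R ⧸ augmentationIdeal R) :
    a • y = augmentation R hN a • y := by
  obtain ⟨b, rfl⟩ := Submodule.Quotient.mk_surjective _ y
  rw [← Submodule.Quotient.mk_smul, ← Submodule.Quotient.mk_smul, Submodule.Quotient.eq,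
    mem_augmentationIdeal_iff R hN]
  simp

theorem augmentation_wordProd (hN : 1 ≤ N) {u : List (Fin q)} (hu : u ≠ []) :
    augmentation R hN (wordProd (basisGen x R) u) = 0 := by
  obtain ⟨c, u, rfl⟩ := List.exists_cons_of_ne_nil hu
  rw [wordProd_cons, map_mul, basisGen, augmentation_gen, zero_mul]

/-- The map from the Koszul complex to the trivial module. -/
def koszulAugmentation :
    koszulWords x R (koszulDegree N 0) →ₗ[Alg R] Alg R ⧸ augmentationIdeal R :=
  (augmentationIdeal R).mkQ ∘ₗ LinearMap.proj [] ∘ₗ (koszulWords x R (koszulDegree N 0)).subtype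

theorem mem_dualWords_of_lt {n : ℕ} (hn : n < N) {f : List (Fin q) → K}
    (hf : ∀ l, l.length ≠ n → f l = 0) : f ∈ dualWords x R n :=
  (mem_dualWords_iff x R).2 ⟨hf, fun _ _ h => by omega⟩

theorem koszulAugmentation_surjective (hN : 1 ≤ N) :
    Function.Surjective (koszulAugmentation x R) := by
  intro y
  obtain ⟨a, rfl⟩ := Submodule.Quotient.mk_surjective _ y
  have h : (Pi.single [] 1 : List (Fin q) → K) ∈ dualWords x R (koszulDegree N 0) :=
    mem_dualWords_of_lt x R hN fun l hl => Pi.single_eq_of_ne (fun h => hl (by simp [h])) 1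
  refine ⟨a • toKoszul x R _ ⟨_, h⟩, ?_⟩
  change (Submodule.Quotient.mk (a • (toKoszul x R _ ⟨_, h⟩).1 []) : _ ⧸ augmentationIdeal R) = _
  rw [toKoszul_coe_apply]
  simp

theorem koszulAugmentation_exact (hN : 2 ≤ N) :
    Function.Exact (koszulMap x R 0) (koszulAugmentation x R) := by
  have hd : ∀ G : koszulWords x R (koszulDegree N 1),
      (koszulMap x R 0 G).1 [] = ∑ c, G.1 [c] * basisGen x R c := by
    intro G
    change (wordD (basisGen x R) ^ 1) G.1 [] = _
    rw [pow_one, wordD_apply]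
  have hker : ∀ F, koszulAugmentation x R F = 0 ↔ F.1 [] ∈ augmentationIdeal R := fun F =>
    Submodule.Quotient.mk_eq_zero _
  intro F
  rw [hker]
  constructor
  · intro hF
    let φ : koszulWords x R (koszulDegree N 1) →ₗ[Alg R] Alg R :=
      LinearMap.proj [] ∘ₗ (koszulWords x R (koszulDegree N 0)).subtype ∘ₗ koszulMap x R 0
    have hI : augmentationIdeal R ≤ LinearMap.range φ := by
      rw [augmentationIdeal, Ideal.span, Submodule.span_le]
      rintro _ ⟨v, rfl⟩
      -- Since `1 < N`, the dual component of degree one is all of `E`, which provides a preimage of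
      -- each generator.
      have h : coord x 1 (PiTensorProduct.tprod K fun _ => v) ∈
          dualWords x R (koszulDegree N 1) :=
        mem_dualWords_of_lt x R (n := 1) (by omega) fun l hl => coord_of_length_ne x _ hl
      refine ⟨toKoszul x R _ ⟨_, h⟩, ?_⟩
      change (koszulMap x R 0 _).1 [] = _
      rw [hd, gen_eq_sum x R v]
      refine Finset.sum_congr rfl fun c _ => ?_
      rw [toKoszul_coe_apply, Algebra.smul_def]
      have := coord_tprod_ofFn x (fun _ : Fin 1 => v) (fun _ => c)
      simp only [List.ofFn_succ, List.ofFn_zero, Fin.prod_univ_one] at this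
      exact congrArg (algebraMap K (Alg R) · * basisGen x R c) this
    obtain ⟨G, hG⟩ := hI hF
    refine ⟨G, ?_⟩
    ext l
    by_cases hl : l = []
    · rw [hl]; exact hG
    · have : l.length ≠ koszulDegree N 0 := fun h => hl (List.length_eq_zero_iff.1 h)
      rw [koszulWords_apply_eq_zero x R _ this, koszulWords_apply_eq_zero x R _ this]
  · rintro ⟨G, rfl⟩
    rw [hd]
    exact sum_mem fun c _ => Ideal.mul_mem_left _ _ (Ideal.subset_span ⟨_, rfl⟩)

end KoszulResolution

/-! ### The dual Koszul complex and the consequences of the Ext conditions. -/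

section DualComplex

variable {K E : Type u} [Field K] [AddCommGroup E] [Module K E] {N q : ℕ}
  (x : Module.Basis (Fin q) K E) {R : Submodule K (⨂[K]^N E)}

theorem koszulHom_ext {Y : Type*} [AddCommGroup Y] [Module (Alg R) Y] {n : ℕ}
    {f g : koszulWords x R n →ₗ[Alg R] Y}
    (h : ∀ t, f (toKoszul x R n t) = g (toKoszul x R n t)) : f = g := by
  ext1 F
  induction F using koszulWords_induction with
  | h0 => simp
  | hadd F G hF hG => rw [map_add, map_add, hF, hG]
  | hsmul a t => rw [map_smul, map_smul, h]

theorem toKoszul_add (n : ℕ) (s t : dualWords x R n) :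
    toKoszul x R n (s + t) = toKoszul x R n s + toKoszul x R n t := by
  simp [toKoszul, TensorProduct.tmul_add]

theorem toKoszul_smul (n : ℕ) (c : K) (t : dualWords x R n) :
    toKoszul x R n (c • t) = algebraMap K (Alg R) c • toKoszul x R n t := by
  rw [toKoszul, toKoszul, ← map_smul, TensorProduct.smul_tmul', ← TensorProduct.smul_tmul,
    smul_eq_mul, mul_one, Algebra.algebraMap_eq_smul_one]

/-- The restriction to `(A^!_n)^*` of an `A`-linear map from `A ⊗ (A^!_n)^*` to `A`. -/
def koszulRestrict {n : ℕ} (f : koszulWords x R n →ₗ[Alg R] Alg R) :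
    dualWords x R n →ₗ[K] Alg R where
  toFun t := f (toKoszul x R n t)
  map_add' s t := by rw [toKoszul_add, map_add]
  map_smul' c t := by
    rw [toKoszul_smul, map_smul, smul_eq_mul, RingHom.id_apply, Algebra.smul_def]

theorem slice_mem_dualWords_koszulDegree {i : ℕ}
    (t : dualWords x R (koszulDegree N (i + 1))) (u : Fin (koszulStep N i) → Fin q) :
    (fun l => t.1 (List.ofFn u ++ l)) ∈ dualWords x R (koszulDegree N i) :=
  slice_left_mem_dualWords (k := koszulStep N i) x R t.2 (by simp)

/-- The coboundary of the complex of the spaces `Hom_K((A^!_n)^*, A)`, where `n` runs over the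
degrees of the terms of the Koszul complex. -/
def coboundary {i : ℕ} (g : dualWords x R (koszulDegree N i) →ₗ[K] Alg R)
    (t : dualWords x R (koszulDegree N (i + 1))) : Alg R :=
  ∑ u : Fin (koszulStep N i) → Fin q, wordProd (basisGen x R) (List.ofFn u) *
    g ⟨_, slice_mem_dualWords_koszulDegree x t u⟩

theorem comp_koszulMap_toKoszul {i : ℕ} (g : koszulWords x R (koszulDegree N i) →ₗ[Alg R] Alg R)
    (t : dualWords x R (koszulDegree N (i + 1))) :
    g (koszulMap x R i (toKoszul x R _ t)) =
      coboundary x (koszulRestrict x g) t := by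
  rw [koszulMap_toKoszul, map_sum]
  exact Finset.sum_congr rfl fun u _ => map_smul g _ _

theorem koszulLift_comp_koszulMap_toKoszul {i : ℕ}
    (g : dualWords x R (koszulDegree N i) →ₗ[K] Alg R)
    (t : dualWords x R (koszulDegree N (i + 1))) :
    koszulLift x R g (koszulMap x R i (toKoszul x R _ t)) =
      coboundary x g t := by
  rw [koszulMap_toKoszul, map_sum]
  refine Finset.sum_congr rfl fun u _ => ?_
  rw [map_smul, koszulLift_toKoszul]
  rfl

theorem one_le_koszulStep (hN : 2 ≤ N) (i : ℕ) : 1 ≤ koszulStep N i := by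
  unfold koszulStep
  split_ifs <;> omega

theorem augmentation_wordProd_ofFn (hN : 1 ≤ N) {k : ℕ} (hk : 1 ≤ k) (u : Fin k → Fin q) :
    augmentation R hN (wordProd (basisGen x R) (List.ofFn u)) = 0 :=
  augmentation_wordProd x R hN (by rw [Ne, List.ofFn_eq_nil_iff]; omega)

/-- Minimality of the resolution: every term of a coboundary starts with a nonempty word. -/
theorem augmentation_coboundary (hN : 2 ≤ N) {i : ℕ}
    (g : dualWords x R (koszulDegree N i) →ₗ[K] Alg R)
    (t : dualWords x R (koszulDegree N (i + 1))) :
    augmentation R (by omega) (coboundary x g t) = 0 := by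
  rw [coboundary, map_sum]
  refine Finset.sum_eq_zero fun u _ => ?_
  rw [map_mul, augmentation_wordProd_ofFn x (by omega) (one_le_koszulStep hN i), zero_mul]

variable (hN : 2 ≤ N) (hK : IsKoszul R)
include hN hK

/-- With values in the trivial module all coboundaries vanish by minimality, so each functional on
the dual component gives a cocycle that can be a coboundary only if it is zero. -/
theorem dualWords_eq_bot_of_hasProjectiveDimensionLT {n : ℕ}
    (h : HasProjectiveDimensionLT (trivialModule R) (n + 1)) :
    dualWords x R (koszulDegree N (n + 1)) = ⊥ := by
  have hN' : 1 ≤ N := by omega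
  rw [eq_bot_iff]
  intro t ht
  suffices (⟨t, ht⟩ : dualWords x R (koszulDegree N (n + 1))) = 0 from congrArg Subtype.val this
  rw [← Module.forall_dual_apply_eq_zero_iff K]
  intro φ
  let e : Alg R ⧸ augmentationIdeal R := Submodule.Quotient.mk 1
  have hw : ∀ {i : ℕ} (u : Fin (koszulStep N i) → Fin q) (y : Alg R ⧸ augmentationIdeal R),
      wordProd (basisGen x R) (List.ofFn u) • y = 0 := fun {i} u y => by
    rw [smul_quotient_augmentationIdeal R hN',
      augmentation_wordProd_ofFn x hN' (one_le_koszulStep hN i)]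
    exact zero_smul K y
  obtain ⟨g, hg⟩ := exists_comp_of_hasProjectiveDimensionLT
    (P := fun i => koszulWords x R (koszulDegree N i)) (koszulMap x R)
    (koszulMap_comp_koszulMap x R hN') (koszulMap_exact x hK hN') (koszulAugmentation x R)
    (koszulAugmentation_surjective x R hN') (koszulAugmentation_exact x R hN) h
    (koszulLift x R (φ.smulRight e)) (koszulHom_ext x fun t => by
      rw [LinearMap.comp_apply, koszulMap_toKoszul, map_sum,
        Finset.sum_eq_zero fun u _ => by rw [map_smul, hw]]
      rfl)
  have := LinearMap.congr_fun hg (toKoszul x R _ ⟨t, ht⟩)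
  rw [koszulLift_toKoszul, LinearMap.comp_apply, koszulMap_toKoszul, map_sum,
    Finset.sum_eq_zero fun u _ => by rw [map_smul, hw], LinearMap.smulRight_apply, eq_comm,
    smul_eq_zero] at this
  refine this.resolve_right fun he => ?_
  rw [Submodule.Quotient.mk_eq_zero, mem_augmentationIdeal_iff R hN', map_one] at he
  exact one_ne_zero he

theorem exists_eq_coboundary {n : ℕ} (h : Limits.IsZero
      (((Ext K (ModuleCat.{u} (Alg R)) (n + 1)).obj (Opposite.op (trivialModule R))).obj
        (ModuleCat.of (Alg R) (Alg R))))
    (f : dualWords x R (koszulDegree N (n + 1)) →ₗ[K] Alg R)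
    (hf : ∀ t : dualWords x R (koszulDegree N (n + 2)),
      coboundary x f t = 0) :
    ∃ g : dualWords x R (koszulDegree N n) →ₗ[K] Alg R,
      ∀ t : dualWords x R (koszulDegree N (n + 1)), f t = coboundary x g t := by
  have hN' : 1 ≤ N := by omega
  obtain ⟨g, hg⟩ := exists_comp_of_isZero_ext
    (P := fun i => koszulWords x R (koszulDegree N i)) (koszulMap x R)
    (koszulMap_comp_koszulMap x R hN') (koszulMap_exact x hK hN') (koszulAugmentation x R)
    (koszulAugmentation_surjective x R hN') (koszulAugmentation_exact x R hN) K (Alg R) h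
    (koszulLift x R f) (koszulHom_ext x fun t => by
      rw [LinearMap.comp_apply, koszulLift_comp_koszulMap_toKoszul, hf]; rfl)
  refine ⟨koszulRestrict x g, fun t => ?_⟩
  rw [← comp_koszulMap_toKoszul, ← LinearMap.comp_apply, hg, koszulLift_toKoszul]

theorem exists_generator_of_finrank_ext_eq_one {n : ℕ} (h : Module.finrank K
      (((Ext K (ModuleCat.{u} (Alg R)) (n + 1)).obj (Opposite.op (trivialModule R))).obj
        (ModuleCat.of (Alg R) (Alg R))) = 1)
    (h0 : dualWords x R (koszulDegree N (n + 2)) = ⊥) :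
    ∃ w : dualWords x R (koszulDegree N (n + 1)), w ≠ 0 ∧ (∀ t, ∃ c : K, t = c • w) ∧
      ∀ a : Alg R, augmentation R (by omega : 1 ≤ N) a = 0 →
        ∃ g : dualWords x R (koszulDegree N n) →ₗ[K] Alg R,
          coboundary x g w = a := by
  have hN' : 1 ≤ N := by omega
  have hs : Subsingleton (koszulWords x R (koszulDegree N (n + 2))) := by
    have : Subsingleton (dualWords x R (koszulDegree N (n + 2))) := by
      rw [h0]; infer_instance
    exact (koszulEquiv x R _).symm.injective.subsingleton
  obtain ⟨⟨f₁, hf₁⟩, key⟩ := exists_smul_add_comp_of_finrank_ext_eq_one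
    (P := fun i => koszulWords x R (koszulDegree N i)) (koszulMap x R)
    (koszulMap_comp_koszulMap x R hN') (koszulMap_exact x hK hN') (koszulAugmentation x R)
    (koszulAugmentation_surjective x R hN') (koszulAugmentation_exact x R hN) K (Alg R) h hs
  -- A class that is not a coboundary needs a nonzero term to live on.
  obtain ⟨w, hw⟩ : ∃ w : dualWords x R (koszulDegree N (n + 1)), w ≠ 0 := by
    by_contra! hw
    refine hf₁ 0 (koszulHom_ext x fun t => ?_)
    have ht : toKoszul x R _ t = 0 := by rw [hw t, toKoszul, TensorProduct.tmul_zero, map_zero]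
    rw [ht, map_zero, map_zero]
  obtain ⟨φ, hφ⟩ : ∃ φ : Module.Dual K (dualWords x R (koszulDegree N (n + 1))), φ w = 1 := by
    obtain ⟨φ, hφ⟩ : ∃ φ : Module.Dual K (dualWords x R (koszulDegree N (n + 1))), φ w ≠ 0 := by
      by_contra! h
      exact hw ((Module.forall_dual_apply_eq_zero_iff K w).1 h)
    exact ⟨(φ w)⁻¹ • φ, by simp [hφ]⟩
  -- The map `t ↦ φ t • 1` takes the value `1` at `w`, which has nonzero augmentation; it is
  -- therefore no coboundary, and its class spans Ext.
  have key' : ∀ f : dualWords x R (koszulDegree N (n + 1)) →ₗ[K] Alg R,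
      ∃ (c : K) (g : dualWords x R (koszulDegree N n) →ₗ[K] Alg R), ∀ t,
        f t = (c * φ t) • 1 + coboundary x g t := by
    intro f
    obtain ⟨c, g, hg⟩ := key (koszulLift x R (φ.smulRight 1)) (fun g hg => by
      have := congrArg (augmentation R hN') (LinearMap.congr_fun hg (toKoszul x R _ w))
      rw [koszulLift_toKoszul, LinearMap.comp_apply, comp_koszulMap_toKoszul,
        augmentation_coboundary x hN] at this
      simp [hφ] at this) (koszulLift x R f)
    refine ⟨c, koszulRestrict x g, fun t => ?_⟩
    have := hg (toKoszul x R _ t)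
    rw [koszulLift_toKoszul, koszulLift_toKoszul, comp_koszulMap_toKoszul] at this
    rw [this, LinearMap.smulRight_apply, smul_eq_mul, ← Algebra.smul_def, smul_smul]
  refine ⟨w, hw, fun t => ⟨φ t, ?_⟩, fun a ha => ?_⟩
  · rw [← sub_eq_zero, ← Module.forall_dual_apply_eq_zero_iff K]
    intro ψ
    -- Taking augmentations removes the coboundary and makes every functional proportional to `φ`,
    -- so the space is a line.
    obtain ⟨c, g, hg⟩ := key' (ψ.smulRight 1)
    have hψ : ∀ t, ψ t = c * φ t := fun t => by
      simpa [augmentation_coboundary x hN] using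
        congrArg (augmentation R hN') (hg t)
    rw [map_sub, map_smul, hψ t, hψ w, hφ, smul_eq_mul, mul_one, mul_comm, sub_self]
  -- Evaluation at `w` gives `a = c + coboundary`, and the augmentation forces `c = 0`.
  · obtain ⟨c, g, hg⟩ := key' (φ.smulRight a)
    have hc := congrArg (augmentation R hN') (hg w)
    rw [map_add, augmentation_coboundary x hN] at hc
    simp [hφ, ha] at hc
    refine ⟨g, ?_⟩
    have := hg w
    rw [← hc] at this
    simpa [hφ] using this.symm

end DualComplex

/-! ### Multilinear forms given by words, and twisted cyclicity. -/

section WordForms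

variable {K : Type u} [Field K] {q : ℕ}

/-- The multilinear form on `K^q` with components given by a function on words. -/
def wordForm (m : ℕ) (w : List (Fin q) → K) : MultilinearMap K (fun _ : Fin m => Fin q → K) K :=
  ∑ u : Fin m → Fin q, w (List.ofFn u) •
    (MultilinearMap.mkPiAlgebra K (Fin m) K).compLinearMap fun i => LinearMap.proj (u i)

theorem wordForm_apply {m : ℕ} (w : List (Fin q) → K) (X : Fin m → Fin q → K) :
    wordForm m w X = ∑ u : Fin m → Fin q, w (List.ofFn u) * ∏ i, X i (u i) := by
  simp [wordForm]

theorem wordForm_single {m : ℕ} (w : List (Fin q) → K) (v : Fin m → Fin q) :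
    wordForm m w (fun i => Pi.single (v i) 1) = w (List.ofFn v) := by
  rw [wordForm_apply, Finset.sum_eq_single v]
  · simp
  · intro u _ hu
    obtain ⟨i, hi⟩ := Function.ne_iff.1 hu
    rw [Finset.prod_eq_zero (Finset.mem_univ i) (Pi.single_eq_of_ne hi 1), mul_zero]
  · simp

theorem wordForm_cons {n : ℕ} (w : List (Fin q) → K) (X : Fin q → K) (Y : Fin n → Fin q → K) :
    wordForm (n + 1) w (Fin.cons X Y) =
      ∑ u : Fin n → Fin q, (∑ c, X c * w (c :: List.ofFn u)) * ∏ i, Y i (u i) := by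
  rw [wordForm_apply, ← (Fin.consEquiv fun _ => Fin q).sum_comp, Fintype.sum_prod_type_right]
  refine Finset.sum_congr rfl fun u _ => ?_
  rw [Finset.sum_mul]
  refine Finset.sum_congr rfl fun c _ => ?_
  simp only [Fin.consEquiv, Equiv.coe_fn_mk, List.ofFn_succ, Fin.cons_zero, Fin.cons_succ,
    Fin.prod_univ_succ]
  ring

theorem wordForm_snoc {n : ℕ} (w : List (Fin q) → K) (X : Fin q → K) (Y : Fin n → Fin q → K) :
    wordForm (n + 1) w (Fin.snoc Y X) =
      ∑ u : Fin n → Fin q, (∑ c, X c * w (List.ofFn u ++ [c])) * ∏ i, Y i (u i) := by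
  rw [wordForm_apply, ← (Fin.snocEquiv fun _ => Fin q).sum_comp, Fintype.sum_prod_type_right]
  refine Finset.sum_congr rfl fun u _ => ?_
  rw [Finset.sum_mul]
  refine Finset.sum_congr rfl fun c _ => ?_
  simp only [Fin.snocEquiv, Equiv.coe_fn_mk, List.ofFn_succ', Fin.snoc_castSucc, Fin.snoc_last,
    Fin.prod_univ_castSucc, List.concat_eq_append]
  ring

variable {w : List (Fin q) → K} {Q : Matrix (Fin q) (Fin q) K}
  (hQ : ∀ c l, w (l ++ [c]) = ∑ b, Q b c * w (b :: l))
  (hw : ∀ X : Fin q → K, (∀ l, ∑ c, X c * w (c :: l) = 0) → X = 0)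
include hQ

/-- Contracting the last slot with `X` gives a contraction of the first slot with `Q X = 0`.
Rotating trailing letters to the front extends the vanishing to every slot; the first slot then
gives injectivity of `Q` by nondegeneracy. -/
theorem sum_mul_eq_zero_of_mulVec_eq_zero {X : Fin q → K} (hX : Q.mulVec X = 0)
    (l l' : List (Fin q)) : ∑ c, X c * w (l ++ [c] ++ l') = 0 := by
  induction l' using List.reverseRecOn generalizing l with
  | nil =>
    simp only [List.append_nil, hQ, Finset.mul_sum]
    rw [Finset.sum_comm]
    refine Finset.sum_eq_zero fun b _ => ?_
    have := congrFun hX b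
    simp only [Matrix.mulVec, dotProduct, Pi.zero_apply] at this
    rw [← zero_mul (w (b :: l)), ← this, Finset.sum_mul]
    exact Finset.sum_congr rfl fun c _ => by ring
  | append_singleton l' a ih =>
    simp only [← List.append_assoc, hQ, Finset.mul_sum]
    rw [Finset.sum_comm]
    refine Finset.sum_eq_zero fun b _ => ?_
    have := congrArg (Q b a * ·) (ih (b :: l))
    simp only [mul_zero, Finset.mul_sum] at this
    rw [← this]
    refine Finset.sum_congr rfl fun c _ => ?_
    simp only [List.cons_append]
    ring

include hw in
theorem isPreregular_wordForm {n : ℕ} (hn : 1 ≤ n) (hsupp : ∀ l, l.length ≠ n + 1 → w l = 0) :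
    IsPreregular (wordForm (n + 1) w) where
  one_le := hn
  nondegenerate X hX := by
    refine hw X fun l => ?_
    by_cases hl : l.length = n
    · obtain ⟨u, rfl⟩ := exists_ofFn_eq hl
      have := hX fun i => Pi.single (u i) 1
      rw [wordForm_cons, Finset.sum_eq_single u] at this
      · simpa using this
      · intro u' _ hu
        obtain ⟨i, hi⟩ := Function.ne_iff.1 hu
        rw [Finset.prod_eq_zero (Finset.mem_univ i) (Pi.single_eq_of_ne hi 1), mul_zero]
      · simp
    · exact Finset.sum_eq_zero fun c _ => by rw [hsupp _ (by simpa using hl), mul_zero]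
  twisted_cyclic := by
    have hinj : Function.Injective Q.mulVecLin := by
      rw [injective_iff_map_eq_zero]
      exact fun X hX => hw X fun l => sum_mul_eq_zero_of_mulVec_eq_zero hQ hX [] l
    refine ⟨LinearEquiv.ofInjectiveEndo Q.mulVecLin hinj, fun Y X => ?_⟩
    rw [wordForm_snoc, wordForm_cons]
    refine Finset.sum_congr rfl fun u _ => ?_
    congr 1
    simp only [LinearEquiv.coe_ofInjectiveEndo, Matrix.mulVecLin_apply, Matrix.mulVec, dotProduct,
      hQ, Finset.mul_sum, Finset.sum_mul]
    rw [Finset.sum_comm]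
    exact Finset.sum_congr rfl fun c _ => Finset.sum_congr rfl fun b _ => by ring

/-- Each use of `hQ` moves one frozen letter from the end of the word to its beginning. -/
theorem slice_right_mem_span_slice_left (l' : List (Fin q)) :
    (fun l => w (l ++ l')) ∈ Submodule.span K
      (Set.range fun u : Fin l'.length → Fin q => fun l => w (List.ofFn u ++ l)) := by
  suffices ∀ j, ∀ l' : List (Fin q), l'.length = j → (fun l => w (l ++ l')) ∈ Submodule.span K
      (Set.range fun u : Fin j → Fin q => fun l => w (List.ofFn u ++ l)) from this _ _ rfl
  intro j
  induction j with
  | zero =>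
    intro l' hl'
    refine Submodule.subset_span ⟨Fin.elim0, ?_⟩
    simp [List.length_eq_zero_iff.1 hl']
  | succ j ih =>
    intro l' hl'
    obtain ⟨l', a, rfl⟩ : ∃ l'' a, l' = l'' ++ [a] := by
      rcases List.eq_nil_or_concat' l' with rfl | h
      · simp at hl'
      · exact h
    -- Rotation puts `b` in front of the free word `l`. Precomposing a left contraction along `u`
    -- with `b :: ·` is the left contraction along `u` followed by `b`.
    have e : (fun l => w (l ++ (l' ++ [a]))) =
        ∑ b, Q b a • LinearMap.funLeft K K (b :: ·) (fun l => w (l ++ l')) := by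
      ext l
      simp [← List.append_assoc, hQ, LinearMap.funLeft]
    rw [e]
    refine sum_mem fun b _ => Submodule.smul_mem _ _ ?_
    have := Submodule.mem_map_of_mem (f := LinearMap.funLeft K K (b :: ·))
      (ih l' (by simpa using hl'))
    rw [Submodule.map_span] at this
    refine Submodule.span_mono ?_ this
    rintro _ ⟨_, ⟨u, rfl⟩, rfl⟩
    refine ⟨Fin.snoc u b, ?_⟩
    ext l
    have : List.ofFn (Fin.snoc u b : Fin (j + 1) → Fin q) = List.ofFn u ++ [b] := by
      simp only [List.ofFn_succ', List.concat_eq_append, Fin.snoc_castSucc, Fin.snoc_last]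
    change w (List.ofFn (Fin.snoc u b : Fin (j + 1) → Fin q) ++ l) = w (List.ofFn u ++ b :: l)
    rw [this, List.append_assoc, List.singleton_append]

end WordForms

/-! ### The relations of a form, in coordinates. -/

section FormRelations

variable {K E : Type u} [Field K] [AddCommGroup E] [Module K E] {N q : ℕ}
  (x : Module.Basis (Fin q) K E)

theorem map_coord_formRelations (w : List (Fin q) → K) {m j : ℕ} (h : m = j + N)
    (hsupp : ∀ l, l.length ≠ m → w l = 0) :
    (formRelations x (wordForm m w) h).map (coord x N) =
      Submodule.span K (Set.range fun u : Fin j → Fin q => fun l => w (List.ofFn u ++ l)) := by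
  rw [formRelations, Submodule.map_span, ← Set.range_comp]
  congr 2
  ext u l
  have hW : ∀ mu : Fin N → Fin q, wordForm m w
      (fun i => Pi.single (Fin.append u mu (Fin.cast h i)) 1) = w (List.ofFn u ++ List.ofFn mu) := by
    intro mu
    subst h
    rw [← List.ofFn_fin_append]
    exact wordForm_single w _
  simp only [Function.comp_apply, map_sum, map_smul, Finset.sum_apply, Pi.smul_apply,
    coord_tprod_basis, hW]
  by_cases hl : l.length = N
  · obtain ⟨v, rfl⟩ := exists_ofFn_eq hl
    simp [List.ofFn_inj]
  · rw [hsupp _ (by simp; omega)]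
    refine Finset.sum_eq_zero fun mu _ => ?_
    rw [if_neg, smul_zero]
    rintro rfl
    simp at hl

end FormRelations

/-! ### Contractions of the generator `w` of the top dual component. -/

section Main

variable {K E : Type u} [Field K] [AddCommGroup E] [Module K E] {N q : ℕ}
  (x : Module.Basis (Fin q) K E) {R : Submodule K (⨂[K]^N E)}

theorem coboundary_smul {i : ℕ} (g : dualWords x R (koszulDegree N i) →ₗ[K] Alg R) (c : K)
    (t : dualWords x R (koszulDegree N (i + 1))) :
    coboundary x g (c • t) = c • coboundary x g t := by
  rw [coboundary, coboundary, Finset.smul_sum]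
  refine Finset.sum_congr rfl fun u _ => ?_
  rw [← mul_smul_comm, ← map_smul]
  rfl

theorem slice_mem_dualWords_of_step_eq {i k : ℕ} (hk : koszulStep N i = k)
    (t : dualWords x R (koszulDegree N (i + 1))) {u : List (Fin q)} (hu : u.length = k) :
    (fun l => t.1 (u ++ l)) ∈ dualWords x R (koszulDegree N i) :=
  slice_left_mem_dualWords (k := koszulStep N i) x R t.2 (hu.trans hk.symm)

theorem coboundary_eq_of_step_eq {i k : ℕ} (hk : koszulStep N i = k)
    (g : dualWords x R (koszulDegree N i) →ₗ[K] Alg R)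
    (t : dualWords x R (koszulDegree N (i + 1))) :
    coboundary x g t = ∑ u : Fin k → Fin q, wordProd (basisGen x R) (List.ofFn u) *
      g ⟨_, slice_mem_dualWords_of_step_eq x hk t (u := List.ofFn u) (by simp)⟩ := by
  subst hk
  rfl

theorem coboundary_eq_of_step_eq_one {i : ℕ} (hi : koszulStep N i = 1)
    (g : dualWords x R (koszulDegree N i) →ₗ[K] Alg R)
    (t : dualWords x R (koszulDegree N (i + 1))) :
    coboundary x g t = ∑ c, basisGen x R c *
      g ⟨fun l => t.1 (c :: l), slice_mem_dualWords_of_step_eq x hi t (u := [c]) rfl⟩ := by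
  rw [coboundary_eq_of_step_eq x hi, ← (Equiv.funUnique (Fin 1) (Fin q)).symm.sum_comp]
  simp

/-- The last differential of the dual Koszul complex has degree one. -/
theorem koszulStep_eq_one_of_surjective (hN : 2 ≤ N) {i : ℕ}
    {w : dualWords x R (koszulDegree N (i + 1))} (hw : w ≠ 0)
    (hsurj : ∀ a : Alg R, augmentation R (by omega : 1 ≤ N) a = 0 →
      ∃ g : dualWords x R (koszulDegree N i) →ₗ[K] Alg R, coboundary x g w = a) :
    koszulStep N i = 1 := by
  have hN' : 1 ≤ N := by omega
  have h1 := one_le_koszulStep hN i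
  by_contra hne
  -- A nonzero `w` of positive degree supplies a letter `c`. The generator `x_c` has a nonzero
  -- coefficient in degree one, whereas a coboundary of step at least two has none.
  obtain ⟨l, hl⟩ : ∃ l, w.1 l ≠ 0 := by
    by_contra! h
    exact hw (Subtype.ext (funext h))
  obtain ⟨c, l, rfl⟩ : ∃ c l', l = c :: l' := by
    refine List.exists_cons_of_ne_nil ?_
    rintro rfl
    refine hl (((mem_dualWords_iff x R).1 w.2).1 [] ?_)
    rw [koszulDegree, List.length_nil]
    omega
  obtain ⟨g, hg⟩ := hsurj (basisGen x R c) (augmentation_gen R hN' _)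
  have h := congrArg (fun a => lowCoeff x R hN' a [c]) hg
  have h2 := lowCoeff_wordProd x R hN' (u := [c]) (l := [c]) le_rfl (by simp; omega)
  simp only [wordProd_cons, wordProd_nil, mul_one, if_true] at h2
  simp only [h2, coboundary, map_sum, Finset.sum_apply] at h
  rw [Finset.sum_eq_zero] at h
  · exact zero_ne_one h
  · intro u _
    rw [lowCoeff_wordProd_mul x R hN' (by simpa using h1) (by simp; omega), if_neg]
    intro e
    have := congrArg List.length e
    simp at this
    omega

/-- Write `x_c = ∑ x_b g(w(b ·))`. Comparing degree-one coefficients, the augmentation of `g` is a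
functional dual to the contraction `w(c ·)`. -/
theorem slices_linearIndependent (hN : 2 ≤ N) {i : ℕ} (hi : koszulStep N i = 1)
    {w : dualWords x R (koszulDegree N (i + 1))}
    (hsurj : ∀ a : Alg R, augmentation R (by omega : 1 ≤ N) a = 0 →
      ∃ g : dualWords x R (koszulDegree N i) →ₗ[K] Alg R, coboundary x g w = a) :
    LinearIndependent K fun c => (⟨fun l => w.1 (c :: l),
      slice_mem_dualWords_of_step_eq x hi w (u := [c]) rfl⟩ : dualWords x R (koszulDegree N i)) := by
  have hN' : 1 ≤ N := by omega
  rw [Fintype.linearIndependent_iff]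
  intro a ha c
  obtain ⟨g, hg⟩ := hsurj (basisGen x R c) (augmentation_gen R hN' _)
  rw [coboundary_eq_of_step_eq_one x hi] at hg
  have key : ∀ b, augmentation R hN' (g ⟨fun l => w.1 (b :: l),
      slice_mem_dualWords_of_step_eq x hi w (u := [b]) rfl⟩) = if b = c then 1 else 0 := by
    intro b
    have h := congrArg (fun a => lowCoeff x R hN' a [b]) hg
    have h1 : ∀ b' y, lowCoeff x R hN' (basisGen x R b' * y) [b] =
        if b = b' then augmentation R hN' y else 0 := fun b' y => by
      simpa using lowCoeff_wordProd_mul x R hN' (u := [b']) (l := [b]) le_rfl (by simp; omega) y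
    have h2 := h1 c 1
    rw [mul_one, map_one] at h2
    simpa [h1, h2] using h
  have := congrArg (fun t => augmentation R hN' (g t)) ha
  simp only [map_sum, map_smul, key, map_zero] at this
  simpa using this

/-- A functional vanishing on all the contractions is a scalar-valued cocycle, hence a coboundary,
hence zero by minimality. -/
theorem slices_span_eq_top (hN : 2 ≤ N) {i : ℕ} (hi : koszulStep N (i + 1) = 1)
    {w : dualWords x R (koszulDegree N (i + 2))} (hw : ∀ t, ∃ c : K, t = c • w)
    (hex : ∀ f : dualWords x R (koszulDegree N (i + 1)) →ₗ[K] Alg R,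
      (∀ t : dualWords x R (koszulDegree N (i + 2)), coboundary x f t = 0) →
      ∃ g : dualWords x R (koszulDegree N i) →ₗ[K] Alg R,
        ∀ t : dualWords x R (koszulDegree N (i + 1)), f t = coboundary x g t) :
    Submodule.span K (Set.range fun c => (⟨fun l => w.1 (c :: l),
      slice_mem_dualWords_of_step_eq x hi w (u := [c]) rfl⟩ :
        dualWords x R (koszulDegree N (i + 1)))) = ⊤ := by
  have hN' : 1 ≤ N := by omega
  by_contra hne
  obtain ⟨φ, hφ, hφ'⟩ := Submodule.exists_le_ker_of_lt_top _ (lt_top_iff_ne_top.2 hne)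
  obtain ⟨g, hg⟩ := hex (φ.smulRight 1) fun t => by
    obtain ⟨c, rfl⟩ := hw t
    rw [coboundary_smul, coboundary_eq_of_step_eq_one x hi, Finset.sum_eq_zero, smul_zero]
    intro c _
    rw [LinearMap.smulRight_apply, hφ' (Submodule.subset_span ⟨c, rfl⟩), zero_smul, mul_zero]
  refine hφ (LinearMap.ext fun t => ?_)
  simpa [augmentation_coboundary x hN] using congrArg (augmentation R hN') (hg t)

theorem sum_ofFn_eq_sum_cons {M : Type*} [AddCommMonoid M] {n k : ℕ} (h : n = k + 1)
    (F : List (Fin q) → M) :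
    ∑ u : Fin n → Fin q, F (List.ofFn u) =
      ∑ c, ∑ u : Fin k → Fin q, F (c :: List.ofFn u) := by
  subst h
  rw [← (Fin.consEquiv fun _ => Fin q).sum_comp, Fintype.sum_prod_type]
  simp [Fin.consEquiv, List.ofFn_succ]

theorem exists_dual_apply_slice_eq (hN : 2 ≤ N) {i : ℕ} (hi : koszulStep N (i + 1) = 1)
    (hi' : koszulStep N i = N - 1)
    {w : dualWords x R (koszulDegree N (i + 2))} (hw : ∀ t, ∃ c : K, t = c • w)
    (hsurj : ∀ a : Alg R, augmentation R (by omega : 1 ≤ N) a = 0 →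
      ∃ g : dualWords x R (koszulDegree N (i + 1)) →ₗ[K] Alg R, coboundary x g w = a)
    (hex : ∀ f : dualWords x R (koszulDegree N (i + 1)) →ₗ[K] Alg R,
      (∀ t : dualWords x R (koszulDegree N (i + 2)), coboundary x f t = 0) →
      ∃ g : dualWords x R (koszulDegree N i) →ₗ[K] Alg R,
        ∀ t : dualWords x R (koszulDegree N (i + 1)), f t = coboundary x g t)
    {r : List (Fin q) → K} (hr : r ∈ R.map (coord x N)) :
    ∃ φ : List (Fin q) → K, ∀ l, l.length = N →
      r l = ∑ v : Fin (koszulDegree N i) → Fin q, φ (List.ofFn v) * w.1 (l ++ List.ofFn v) := by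
  have hN' : 1 ≤ N := by omega
  let b := Module.Basis.mk (slices_linearIndependent x hN hi hsurj)
    (slices_span_eq_top x hN hi hw hex).ge
  have hb : ∀ c, b c = ⟨fun l => w.1 (c :: l),
      slice_mem_dualWords_of_step_eq x hi w (u := [c]) rfl⟩ := fun c =>
    Module.Basis.mk_apply _ _ c
  -- The contractions form a basis, so `f` may send `w(c ·)` to what remains of `r` after its first
  -- letter `c`. Its coboundary at `w` is the image of `r` in `A`, which is zero.
  let f : dualWords x R (koszulDegree N (i + 1)) →ₗ[K] Alg R := b.constr K fun c =>
    ∑ u : Fin (N - 1) → Fin q, r (c :: List.ofFn u) • wordProd (basisGen x R) (List.ofFn u)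
  have hf : ∀ c, f (b c) = ∑ u : Fin (N - 1) → Fin q,
      r (c :: List.ofFn u) • wordProd (basisGen x R) (List.ofFn u) := fun c =>
    b.constr_basis K _ c
  obtain ⟨g, hg⟩ := hex f fun t => by
    obtain ⟨c, rfl⟩ := hw t
    rw [coboundary_smul, coboundary_eq_of_step_eq_one x hi]
    convert smul_zero c
    rw [← sum_smul_wordProd_of_mem x R hr, sum_ofFn_eq_sum_cons (show N = N - 1 + 1 by omega)
      fun l => r l • wordProd (basisGen x R) l]
    refine Finset.sum_congr rfl fun c _ => ?_
    rw [← hb, hf, Finset.mul_sum]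
    exact Finset.sum_congr rfl fun u _ => by rw [mul_smul_comm, wordProd_cons]
  -- Extending to all functions on words lets the functional be evaluated on single words, which
  -- yields the coefficients `φ`.
  obtain ⟨ψ, hψ⟩ := LinearMap.exists_extend ((augmentation R hN').toLinearMap ∘ₗ g)
  refine ⟨fun l => ψ (Pi.single l 1), fun l hl => ?_⟩
  have hψ' : ∀ t : dualWords x R (koszulDegree N i), augmentation R hN' (g t) =
      ∑ v : Fin (koszulDegree N i) → Fin q, ψ (Pi.single (List.ofFn v) 1) * t.1 (List.ofFn v) := by
    intro t
    have ht : t.1 = ∑ v : Fin (koszulDegree N i) → Fin q,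
        t.1 (List.ofFn v) • (Pi.single (List.ofFn v) 1 : List (Fin q) → K) := by
      ext l
      by_cases hl : l.length = koszulDegree N i
      · obtain ⟨v, rfl⟩ := exists_ofFn_eq hl
        simp [Pi.single_apply, List.ofFn_inj]
      · rw [((mem_dualWords_iff x R).1 t.2).1 l hl, Finset.sum_apply, Finset.sum_eq_zero]
        intro v _
        rw [Pi.smul_apply, Pi.single_eq_of_ne, smul_zero]
        rintro rfl
        simp at hl
    have := LinearMap.congr_fun hψ t
    change ψ t.1 = augmentation R hN' (g t) at this
    rw [← this]
    conv_lhs => rw [ht]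
    simp [mul_comm]
  obtain ⟨c, l, rfl⟩ := List.exists_cons_of_length_pos (show 0 < l.length by omega)
  have hl' : l.length = N - 1 := by simp at hl; omega
  have h := hg (b c)
  rw [hf, coboundary_eq_of_step_eq x hi'] at h
  -- Both sides are compared in degree `N - 1`, where `A` has no relations yet.
  have h' := congrArg (fun a => lowCoeff x R hN' a l) h
  obtain ⟨u, rfl⟩ := exists_ofFn_eq hl'
  have h₁ : ∀ v : Fin (N - 1) → Fin q, ∀ y,
      lowCoeff x R hN' (wordProd (basisGen x R) (List.ofFn v) * y) (List.ofFn u) =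
        if u = v then augmentation R hN' y else 0 := fun v y => by
    rw [lowCoeff_wordProd_mul x R hN' (by simp) (by omega)]
    simp only [List.ofFn_inj]
  have h₂ : ∀ v : Fin (N - 1) → Fin q,
      lowCoeff x R hN' (wordProd (basisGen x R) (List.ofFn v)) (List.ofFn u) =
        if u = v then 1 else 0 := fun v => by simpa using h₁ v 1
  simp only [map_sum, map_smul, Finset.sum_apply, Pi.smul_apply, h₁, h₂, hψ', hb] at h'
  simpa using h'

end Main

/-! ### Assembly: preregularity of `w` and recovery of `R`. -/

section Main

variable {K E : Type u} [Field K] [AddCommGroup E] [Module K E] {N q : ℕ}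
  (x : Module.Basis (Fin q) K E) {R : Submodule K (⨂[K]^N E)}

theorem hasProjectiveDimensionLT_of_globalDimension_eq {A : Type u} [Ring A] {D : ℕ}
    (h : globalDimension A = (D : WithBot ℕ∞)) (M : ModuleCat.{u} A) :
    HasProjectiveDimensionLT M (D + 1) := by
  have : projectiveDimension M ≤ (D : WithBot ℕ∞) := h ▸ le_iSup (fun M => projectiveDimension M) M
  exact (projectiveDimension_le_iff M D).1 this

theorem slices_mem_map_coord {j : ℕ} {w : List (Fin q) → K} (hw : w ∈ dualWords x R (j + N))
    (u : Fin j → Fin q) : (fun l => w (List.ofFn u ++ l)) ∈ R.map (coord x N) := by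
  rw [mem_dualWords_iff] at hw
  simpa using hw.2 (List.ofFn u) [] (by simp)

theorem map_coord_le_span_slices {j : ℕ} {w : List (Fin q) → K}
    (hsupp : ∀ l, l.length ≠ j + N → w l = 0) {Q : Matrix (Fin q) (Fin q) K}
    (hQ : ∀ c l, w (l ++ [c]) = ∑ b, Q b c * w (b :: l))
    (h : ∀ r ∈ R.map (coord x N), ∃ φ : List (Fin q) → K, ∀ l, l.length = N →
      r l = ∑ v : Fin j → Fin q, φ (List.ofFn v) * w (l ++ List.ofFn v)) :
    R.map (coord x N) ≤
      Submodule.span K (Set.range fun u : Fin j → Fin q => fun l => w (List.ofFn u ++ l)) := by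
  intro r hr
  obtain ⟨φ, hφ⟩ := h r hr
  have : r = ∑ v : Fin j → Fin q, φ (List.ofFn v) • fun l => w (l ++ List.ofFn v) := by
    ext l
    rw [Finset.sum_apply]
    by_cases hl : l.length = N
    · exact hφ l hl
    · obtain ⟨ρ, -, rfl⟩ := hr
      rw [coord_of_length_ne x ρ hl, Finset.sum_eq_zero]
      intro v _
      rw [Pi.smul_apply, hsupp _ (by simp; omega), smul_zero]
  rw [this]
  refine sum_mem fun v _ => Submodule.smul_mem _ _ ?_
  have := slice_right_mem_span_slice_left hQ (List.ofFn v)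
  rwa [List.length_ofFn] at this

theorem exists_isPreregular_of_isGorenstein (hN : 2 ≤ N) {i : ℕ} (hK : IsKoszul R)
    (hdim : globalDimension (Alg R) = ((i + 2 : ℕ) : WithBot ℕ∞)) (hG : IsGorenstein R (i + 2)) :
    koszulStep N (i + 1) = 1 ∧ ∃ (n : ℕ) (h : n + 1 = koszulDegree N i + N)
      (W : MultilinearMap K (fun _ : Fin (n + 1) => Fin q → K) K),
      IsPreregular W ∧ R = formRelations x W h := by
  have hN' : 1 ≤ N := by omega
  obtain ⟨w, hw0, hw, hsurj⟩ := exists_generator_of_finrank_ext_eq_one x hN hK hG.finrank_ext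
    (dualWords_eq_bot_of_hasProjectiveDimensionLT x hN hK
      (hasProjectiveDimensionLT_of_globalDimension_eq hdim _))
  have hi := koszulStep_eq_one_of_surjective x hN hw0 hsurj
  have hi' : koszulStep N i = N - 1 := by
    have := koszulStep_add_koszulStep hN' i
    omega
  have hex := exists_eq_coboundary x hN hK (hG.isZero_ext (i + 1) (by omega))
  refine ⟨hi, ?_⟩
  -- The form has `m = ν(D)` arguments, and the first `ν(D - 2)` of them index the relations.
  have hdeg : koszulDegree N (i + 2) = koszulDegree N i + N := by
    rw [koszulDegree, koszulDegree, hi, hi']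
    omega
  have hw2 : w.1 ∈ dualWords x R (koszulDegree N i + N) := hdeg ▸ w.2
  have hsupp := ((mem_dualWords_iff x R).1 hw2).1
  have hspan := slices_span_eq_top x hN hi hw hex
  have hli := slices_linearIndependent x hN hi hsurj
  -- The dual component is defined symmetrically on both sides, so right contractions land in the
  -- space spanned by the left ones.
  have hright : ∀ c, (fun l => w.1 (l ++ [c])) ∈ dualWords x R (koszulDegree N (i + 1)) :=
    fun c => slice_right_mem_dualWords (k := koszulStep N (i + 1)) x R w.2 (by rw [hi]; rfl)
  have hcyc : ∀ c, ∃ a : Fin q → K, ∀ l, w.1 (l ++ [c]) = ∑ b, a b * w.1 (b :: l) := by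
    intro c
    obtain ⟨a, ha⟩ := (Submodule.mem_span_range_iff_exists_fun K).1
      (hspan ▸ Submodule.mem_top : (⟨_, hright c⟩ : dualWords x R (koszulDegree N (i + 1))) ∈ _)
    refine ⟨a, fun l => ?_⟩
    have := congrArg (fun t => (dualWords x R (koszulDegree N (i + 1))).subtype t l) ha
    simpa using this.symm
  choose a ha using hcyc
  have hnd : ∀ X : Fin q → K, (∀ l, ∑ c, X c * w.1 (c :: l) = 0) → X = 0 := by
    intro X hX
    refine funext (Fintype.linearIndependent_iff.1 hli X (Subtype.ext (funext fun l => ?_)))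
    simpa using hX l
  obtain ⟨n, hn⟩ : ∃ n, n + 1 = koszulDegree N i + N := ⟨koszulDegree N i + N - 1, by omega⟩
  have hQ : ∀ c l, w.1 (l ++ [c]) = ∑ b, Matrix.of (fun b c => a c b) b c * w.1 (b :: l) := ha
  refine ⟨n, hn, wordForm (n + 1) w.1, isPreregular_wordForm hQ hnd (by omega) (hn ▸ hsupp), ?_⟩
  apply Submodule.map_injective_of_injective (coord_injective x N)
  rw [map_coord_formRelations x w.1 hn (hn ▸ hsupp)]
  apply le_antisymm
  · exact map_coord_le_span_slices x hsupp hQ fun r hr =>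
      exists_dual_apply_slice_eq x hN hi hi' hw hsurj hex hr
  · rw [Submodule.span_le]
    rintro _ ⟨u, rfl⟩
    exact slices_mem_map_coord x hw2 u

end Main

end

end NHomogeneous

theorem theorem4p3 {K E : Type u} [Field K] [IsAlgClosed K] [CharZero K]
    [AddCommGroup E] [Module K E] {q : ℕ} (x : Module.Basis (Fin q) K E)
    (N D : ℕ) (hN : 2 ≤ N) (hD : 2 ≤ D) (R : Submodule K (⨂[K]^N E))
    (hKoszul : NHomogeneous.IsKoszul R)
    (hdim : NHomogeneous.globalDimension (NHomogeneous.Alg R) = (D : WithBot ℕ∞))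
    (hGor : NHomogeneous.IsGorenstein R D) :
    q = Module.finrank K (NHomogeneous.component R 1) ∧
    ∃ (n j : ℕ) (h : n + 1 = j + N)
      (W : MultilinearMap K (fun _ : Fin (n + 1) => Fin q → K) K),
      NHomogeneous.IsPreregular W ∧
      R = NHomogeneous.formRelations x W h ∧
      (3 ≤ N → ∃ p : ℕ, 1 ≤ p ∧ n + 1 = N * p + 1 ∧ D = 2 * p + 1) ∧
      (N = 2 → n + 1 = D) := by
  refine ⟨(NHomogeneous.finrank_component_one x R hN).symm, ?_⟩
  obtain ⟨i, rfl⟩ := Nat.exists_eq_add_of_le' hD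
  obtain ⟨hi, n, h, W, hW, hR⟩ :=
    NHomogeneous.exists_isPreregular_of_isGorenstein x hN hKoszul hdim hGor
  have hN' : 1 ≤ N := by omega
  refine ⟨n, _, h, W, hW, hR, fun h3 => ?_, ?_⟩
  -- For `N ≥ 3` the step `N - 1` differs from `1`, so the last index `i + 1` is even. With `i = 2k
  -- + 1` this gives `p = k + 1`.
  · have hodd : Odd i := by
      by_contra hodd
      rw [NHomogeneous.koszulStep, if_neg (by simpa [Nat.even_add_one] using hodd)] at hi
      omega
    obtain ⟨k, rfl⟩ := hodd
    refine ⟨k + 1, by omega, ?_, by omega⟩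
    rw [h, NHomogeneous.koszulDegree_two_mul_add_one hN', mul_add]
    omega
  · rintro rfl
    rw [h]
    obtain ⟨k, rfl | rfl⟩ := Nat.even_or_odd' i
    · rw [NHomogeneous.koszulDegree_two_mul hN']
    · rw [NHomogeneous.koszulDegree_two_mul_add_one hN']
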